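/- Let $Q=(0,1)\times(0,1)\subset\mathbb{R}^2$ be the unit square. A potential in $Q$ is a non-negative function $V\in L^1_{loc}(Q)$. For such $V$ let $$\mathcal{F}_{V,Q}=\Big\{f\in L^2_{loc}(Q):\ \int_Q|\nabla f|^2\,dx<\infty,\ \int_Q Vf^2\,dx<\infty\Big\},\qquad \mathcal{E}_{V,Q}(f)=\int_Q|\nabla f|^2\,dx-\int_Q Vf^2\,dx,$$ where functions are real-valued and identified when equal almost everywhere, and $\nabla f$ is the distributional gradient, and let $\mathrm{Neg}(V,Q)$ be the supremum of $\dim\mathcal{V}$ over all linear subspaces $\mathcal{V}$ of $\mathcal{F}_{V,Q}$ such that $\mathcal{E}_{V,Q}(f)\le 0$ for all $f\in\mathcal{V}$ (the Morse index of the form $\mathcal{E}_{V,Q}$, which plays the role of the number of non-positive eigenvalues of the Neumann problem for $-\Delta-V$ in $Q$). Then for every real $p>1$ there is a finite constant $C$ depending only on $p$ such that, for every potential $V$ in $Q$, $$\mathrm{Neg}(V,Q)\le 1+C\,\|V\|_{L^p(Q)}.$$ If $\|V\|_{L^p(Q)}=\infty$, the right-hand side is understood as $+\infty$. -/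

import Mathlib

open MeasureTheory Set
open scoped ENNReal NNReal ContDiff

noncomputable section

/-- The Euclidean plane `ℝ²`, with its Euclidean norm and Lebesgue measure. -/
abbrev Plane : Type := EuclideanSpace ℝ (Fin 2)

/-- A potential in `Ω`: a non-negative function from `L¹_loc(Ω)`
(only the values of `V` on `Ω`, up to null sets, matter). -/
structure IsPotential (Ω : Set Plane) (V : Plane → ℝ) : Prop where
  nonneg : ∀ᵐ x ∂volume.restrict Ω, 0 ≤ V x
  locallyIntegrable : LocallyIntegrableOn V Ω volume

/-- `f ∈ L²_loc(Ω)`. -/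
def IsL2Loc (Ω : Set Plane) (f : Plane → ℝ) : Prop :=
  ∀ K : Set Plane, K ⊆ Ω → IsCompact K → MemLp f 2 (volume.restrict K)

/-- `g ∈ L¹_loc(Ω; ℝ²)` is the gradient of `f` in `Ω` in the sense of distributions:
`∫_Ω f ∂ᵢφ = - ∫_Ω gᵢ φ` for all `φ ∈ C_c^∞(Ω)` and `i = 1, 2`. -/
structure HasWeakGradient (Ω : Set Plane) (f : Plane → ℝ) (g : Plane → Plane) : Prop where
  locallyIntegrable : LocallyIntegrableOn g Ω volume
  integral_eq : ∀ φ : Plane → ℝ, ContDiff ℝ ∞ φ → HasCompactSupport φ → tsupport φ ⊆ Ω →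
    ∀ i : Fin 2,
      ∫ x in Ω, f x * fderiv ℝ φ x (EuclideanSpace.single i 1) = -∫ x in Ω, g x i * φ x

/-- The weak gradient is unique up to null sets. -/
theorem HasWeakGradient.ae_eq {Ω : Set Plane} (hΩ : IsOpen Ω) {f : Plane → ℝ}
    {g h : Plane → Plane} (hg : HasWeakGradient Ω f g) (hh : HasWeakGradient Ω f h) :
    g =ᵐ[volume.restrict Ω] h := by
  have key : ∀ i : Fin 2, ∀ᵐ x ∂volume, x ∈ Ω → g x i - h x i = 0 := by
    intro i
    have hli : ∀ {k : Plane → Plane}, LocallyIntegrableOn k Ω volume →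
        LocallyIntegrableOn (fun x => k x i) Ω volume := by
      intro k hk x hx
      obtain ⟨s, hs, hks⟩ := hk x hx
      exact ⟨s, hs, (EuclideanSpace.proj (𝕜 := ℝ) i).integrable_comp hks⟩
    refine hΩ.ae_eq_zero_of_integral_contDiff_smul_eq_zero
      ((hli hg.locallyIntegrable).sub (hli hh.locallyIntegrable)) ?_
    intro φ hφ hc hs
    have e := (hg.integral_eq φ hφ hc hs i).symm.trans (hh.integral_eq φ hφ hc hs i)
    have hint : ∀ {k : Plane → Plane}, LocallyIntegrableOn k Ω volume →
        Integrable (fun x => k x i * φ x) volume := by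
      intro k hk
      have h1 : IntegrableOn (fun x => k x i) (tsupport φ) volume :=
        (hli hk).integrableOn_compact_subset hs hc
      have h2 := h1.mul_continuousOn hφ.continuous.continuousOn hc
      refine (integrableOn_iff_integrable_of_support_subset ?_).1 h2
      intro x hx
      exact subset_tsupport φ (right_ne_zero_of_mul hx)
    have hset : ∀ k : Plane → Plane,
        ∫ x in Ω, k x i * φ x = ∫ x, k x i * φ x := by
      intro k
      refine setIntegral_eq_integral_of_forall_compl_eq_zero ?_
      intro x hx
      rw [image_eq_zero_of_notMem_tsupport (fun h' => hx (hs h')), mul_zero]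
    rw [hset g, hset h] at e
    have : (fun x => φ x • (g x i - h x i))
        = fun x => g x i * φ x - h x i * φ x := by
      funext x
      simp only [smul_eq_mul]
      ring
    change ∫ x, φ x • (g x i - h x i) = 0
    rw [this, integral_sub (hint hg.locallyIntegrable) (hint hh.locallyIntegrable)]
    linarith
  rw [Filter.EventuallyEq, ae_restrict_iff' hΩ.measurableSet]
  filter_upwards [key 0, key 1] with x h0 h1 hx
  ext i
  fin_cases i
  · exact sub_eq_zero.1 (h0 hx)
  · exact sub_eq_zero.1 (h1 hx)

open Classical in
/-- The weak gradient `∇f` of `f` in `Ω` (set to be `0` if there is none). -/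
def weakGradient (Ω : Set Plane) (f : Plane → ℝ) : Plane → Plane :=
  if h : ∃ g, HasWeakGradient Ω f g then h.choose else 0

/-- The space `F_{V,Ω}` of all `f ∈ L²_loc(Ω)` with `∫_Ω |∇f|² < ∞` and `∫_Ω V f² < ∞`,
functions on `Ω` being identified when they agree almost everywhere. -/
def formDomain (Ω : Set Plane) (V : Plane → ℝ) : Set (Plane →ₘ[volume.restrict Ω] ℝ) :=
  {f | IsL2Loc Ω f ∧
    (∃ g, HasWeakGradient Ω f g ∧ MemLp g 2 (volume.restrict Ω)) ∧
    IntegrableOn (fun x => V x * f x ^ 2) Ω volume}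

/-- The energy form `E_{V,Ω}(f) = ∫_Ω |∇f|² - ∫_Ω V f²`. -/
def energyForm (Ω : Set Plane) (V : Plane → ℝ) (f : Plane →ₘ[volume.restrict Ω] ℝ) : ℝ :=
  (∫ x in Ω, ‖weakGradient Ω f x‖ ^ 2) - ∫ x in Ω, V x * f x ^ 2

/-- `Neg(V, Ω)`: the supremum of the dimensions of the linear subspaces of `F_{V,Ω}` on which
`E_{V,Ω} ≤ 0`. -/
def morseIndex (V : Plane → ℝ) (Ω : Set Plane) : ℕ∞ :=
  ⨆ (W : Submodule ℝ (Plane →ₘ[volume.restrict Ω] ℝ))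
    (_ : (∀ f ∈ W, f ∈ formDomain Ω V) ∧ ∀ f ∈ W, energyForm Ω V f ≤ 0),
    Cardinal.toENat (Module.rank ℝ W)

/-- The open unit square `(0,1)²`. -/
def unitSquare : Set Plane := {x | 0 < x 0 ∧ x 0 < 1 ∧ 0 < x 1 ∧ x 1 < 1}

end

/-!
For each dyadic subsquare `S` of the unit square with side `2⁻ᵏ`, let `m_S f` be the
average of `f` against a fixed smooth bump rescaled to `S`. The difference `m_S f - m_{S'} f` for
a child `S'` of `S` is the integral of `∇f` against an explicit smooth field supported in `S`,
hence at most `B (∫_S |∇f|²)^(1/2)` with `B` independent of the scale, since the dimension is two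
(`enorm_cellMean_sub_le`). By Lebesgue differentiation (`ae_tendsto_cellMean`) `f` is almost
everywhere the telescoping sum of these differences along the squares containing the point. This
replaces the Sobolev inequality, and it uses `f` only on compact subsets of the open square.

Give `S` the weight `u_S = (|S|^(1 - 1/p) ‖V‖_{L^p(S)})^(1/2)`. By Hölder's inequality
`∫_S V ≤ u_S²`, and weights of children are smaller by a factor at most `r = 2^(-(1 - 1/p)) < 1`.
Call `S` heavy if `u_S > d`, for a small constant `d` depending on `p` only. If `m_S f = 0` for the
unit square and for all children of heavy squares, then only the light squares contribute to the
telescoping sum. Cauchy–Schwarz with weights `u_S` gives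
`∫ V f² ≤ (B d / (1 - r))² ∫ |∇f|² ≤ ¼ ∫ |∇f|²`
(`lintegral_mul_sq_le_of_dyadic`, `lintegral_potential_mul_sq_le`). On a space where the energy is
nonpositive such an `f` has vanishing gradient, so it vanishes. The Morse index is therefore at
most one plus four times the number of heavy squares.

At level `k` there are at most `4ᵏ` heavy squares, and, because `∫_S |V|^p` is additive in `S`, at
most `Aᵖ 4^(-k(p-1))` with `A = ‖V‖_{L^p} / d²`. The sum over `k` of the smaller of the two bounds
is dominated by the scale `4ᵏ ≈ A` and is linear in `A` (`exists_card_heavyCells_le`). The unit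
square itself is the only source of the additive constant one.
-/

/-! ### Dyadic squares -/

/-- The index of the half-open dyadic square of side `2⁻ᵏ` containing the point `x` of the
first quadrant. -/
noncomputable def dyadicIndex (k : ℕ) (x : Plane) : ℕ × ℕ :=
  (⌊2 ^ k * x 0⌋₊, ⌊2 ^ k * x 1⌋₊)

/-- The part inside the open unit square of the half-open dyadic square of side `2⁻ᵏ`
with index `z`. Restricting to the unit square makes the cells of one level a genuine partition
of it. -/
def dyadicCell (k : ℕ) (z : ℕ × ℕ) : Set Plane := unitSquare ∩ dyadicIndex k ⁻¹' {z}

/-- The index of the dyadic square of the previous level that contains the square of index `z`. -/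
def dyadicParent (z : ℕ × ℕ) : ℕ × ℕ := (z.1 / 2, z.2 / 2)

theorem dyadicParent_dyadicIndex (k : ℕ) (x : Plane) :
    dyadicParent (dyadicIndex (k + 1) x) = dyadicIndex k x := by
  have h : ∀ t : ℝ, ⌊2 ^ (k + 1) * t⌋₊ / 2 = ⌊2 ^ k * t⌋₊ := fun t => by
    rw [← Nat.floor_div_ofNat]
    congr 1
    rw [pow_succ]
    ring
  simp [dyadicParent, dyadicIndex, h]

theorem isOpen_unitSquare : IsOpen unitSquare := by
  have h : ∀ i : Fin 2, Continuous fun x : Plane => x i := fun i => by fun_prop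
  exact (isOpen_lt continuous_const (h 0)).inter ((isOpen_lt (h 0) continuous_const).inter
    ((isOpen_lt continuous_const (h 1)).inter (isOpen_lt (h 1) continuous_const)))

theorem measurableSet_unitSquare : MeasurableSet unitSquare := isOpen_unitSquare.measurableSet

theorem measurable_dyadicIndex (k : ℕ) : Measurable (dyadicIndex k) := by
  have h : ∀ i : Fin 2, Measurable fun x : Plane => x i := fun i => by fun_prop
  exact (Nat.measurable_floor.comp ((h 0).const_mul _)).prodMk
    (Nat.measurable_floor.comp ((h 1).const_mul _))

theorem measurableSet_dyadicCell (k : ℕ) (z : ℕ × ℕ) : MeasurableSet (dyadicCell k z) :=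
  measurableSet_unitSquare.inter (measurable_dyadicIndex k (measurableSet_singleton z))

theorem dyadicCell_subset_unitSquare (k : ℕ) (z : ℕ × ℕ) : dyadicCell k z ⊆ unitSquare :=
  inter_subset_left

theorem dyadicCell_subset_parent (k : ℕ) (z : ℕ × ℕ) :
    dyadicCell (k + 1) z ⊆ dyadicCell k (dyadicParent z) := by
  rintro x ⟨hx, rfl⟩
  exact ⟨hx, (dyadicParent_dyadicIndex k x).symm⟩

theorem iUnion_dyadicCell (k : ℕ) : ⋃ z, dyadicCell k z = unitSquare := by
  ext x
  simp [dyadicCell]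

theorem pairwise_disjoint_dyadicCell (k : ℕ) :
    Pairwise (Function.onFun Disjoint (dyadicCell k)) := by
  intro z w hzw
  refine disjoint_left.2 ?_
  rintro x ⟨-, rfl⟩ ⟨-, hx⟩
  exact hzw hx

theorem lintegral_unitSquare_eq_tsum (k : ℕ) (F : Plane → ℝ≥0∞) :
    ∫⁻ x in unitSquare, F x = ∑' z, ∫⁻ x in dyadicCell k z, F x := by
  rw [← iUnion_dyadicCell k]
  exact lintegral_iUnion (measurableSet_dyadicCell k) (pairwise_disjoint_dyadicCell k) F

/-- A factor depending only on the dyadic cell can be pulled out of the integral cell by cell. -/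
theorem lintegral_dyadicIndex_mul (k : ℕ) (w : ℕ × ℕ → ℝ≥0∞) {F : Plane → ℝ≥0∞}
    (hF : AEMeasurable F (volume.restrict unitSquare)) :
    ∫⁻ x in unitSquare, w (dyadicIndex k x) * F x
      = ∑' z, w z * ∫⁻ x in dyadicCell k z, F x := by
  rw [lintegral_unitSquare_eq_tsum k]
  refine tsum_congr fun z => ?_
  rw [← lintegral_const_mul'' _ (hF.mono_measure
    (Measure.restrict_mono (dyadicCell_subset_unitSquare k z) le_rfl))]
  refine setLIntegral_congr_fun (measurableSet_dyadicCell k z) ?_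
  rintro x ⟨-, rfl⟩
  rfl

/-- Coordinate bounds for a point of the square with index `n` at level `k`. -/
theorem floor_mul_two_pow_bounds {k n : ℕ} {t : ℝ} (ht : 0 ≤ t) (h : ⌊2 ^ k * t⌋₊ = n) :
    (n : ℝ) / 2 ^ k ≤ t ∧ t < (n : ℝ) / 2 ^ k + 1 / 2 ^ k := by
  have hk : (0 : ℝ) < 2 ^ k := by positivity
  have := (Nat.floor_eq_iff (by positivity)).1 h
  rw [← add_div, div_le_iff₀ hk, lt_div_iff₀ hk, mul_comm t]
  exact this

theorem dyadicIndex_lt {k : ℕ} {x : Plane} (hx : x ∈ unitSquare) :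
    (dyadicIndex k x).1 < 2 ^ k ∧ (dyadicIndex k x).2 < 2 ^ k := by
  have h : ∀ t : ℝ, 0 < t → t < 1 → ⌊2 ^ k * t⌋₊ < 2 ^ k := fun t h0 h1 => by
    rw [Nat.floor_lt (by positivity)]
    push_cast
    exact mul_lt_of_lt_one_right (by positivity) h1
  exact ⟨h _ hx.1 hx.2.1, h _ hx.2.2.1 hx.2.2.2⟩

theorem volume_dyadicCell_le (k : ℕ) (z : ℕ × ℕ) :
    volume (dyadicCell k z) ≤ ENNReal.ofReal ((1 / 4) ^ k) := by
  set a : Fin 2 → ℝ := ![(z.1 : ℝ) / 2 ^ k, (z.2 : ℝ) / 2 ^ k] with ha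
  set b : Fin 2 → ℝ := fun i => a i + 1 / 2 ^ k with hb
  have hsub : dyadicCell k z ⊆
      (MeasurableEquiv.toLp 2 (Fin 2 → ℝ)).symm ⁻¹' (univ.pi fun i => Ico (a i) (b i)) := by
    rintro x ⟨hx, hz⟩
    obtain ⟨h0, h1⟩ := Prod.ext_iff.1 (show dyadicIndex k x = z from hz)
    have e0 := floor_mul_two_pow_bounds hx.1.le h0
    have e1 := floor_mul_two_pow_bounds hx.2.2.1.le h1
    intro i _
    fin_cases i
    · exact e0
    · exact e1
  refine (measure_mono hsub).trans (le_of_eq ?_)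
  rw [(EuclideanSpace.volume_preserving_symm_measurableEquiv_toLp (Fin 2)).measure_preimage
    (MeasurableSet.univ_pi fun i => measurableSet_Ico).nullMeasurableSet, Real.volume_pi_Ico]
  simp only [hb, add_sub_cancel_left, Fin.prod_univ_two]
  rw [← ENNReal.ofReal_mul (by positivity)]
  congr 1
  rw [← one_div_pow, ← mul_pow]
  norm_num

/-! ### Dyadic bump functions on the line -/

/-- A smooth step: `0` for `t ≤ 1/4`, `1` for `t ≥ 3/4`. -/
noncomputable def smoothStep (t : ℝ) : ℝ := Real.smoothTransition (2 * t - 1 / 2)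

/-- The smooth bump on the dyadic interval `[i 2⁻ᵏ, (i + 1) 2⁻ᵏ]`, of integral one. -/
noncomputable def dyadicBump (k i : ℕ) (t : ℝ) : ℝ := 2 ^ k * deriv smoothStep (2 ^ k * t - i)

/-- The compactly supported primitive of `dyadicBump k (j / 2) - dyadicBump (k + 1) j`. -/
noncomputable def dyadicPrimitive (k j : ℕ) (t : ℝ) : ℝ :=
  smoothStep (2 ^ k * t - (j / 2 : ℕ)) - smoothStep (2 ^ (k + 1) * t - j)

theorem smoothStep_of_le {t : ℝ} (ht : t ≤ 1 / 4) : smoothStep t = 0 :=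
  Real.smoothTransition.zero_of_nonpos (by linarith)

theorem smoothStep_of_ge {t : ℝ} (ht : 3 / 4 ≤ t) : smoothStep t = 1 :=
  Real.smoothTransition.one_of_one_le (by linarith)

theorem contDiff_smoothStep : ContDiff ℝ ∞ smoothStep := by
  have h : ContDiff ℝ ∞ Real.smoothTransition := Real.smoothTransition.contDiff
  exact h.comp (by fun_prop)

theorem contDiff_deriv_smoothStep : ContDiff ℝ ∞ (deriv smoothStep) :=
  (contDiff_infty_iff_deriv.1 contDiff_smoothStep).2

theorem hasDerivAt_smoothStep (t : ℝ) : HasDerivAt smoothStep (deriv smoothStep t) t :=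
  ((contDiff_smoothStep.differentiable (by simp)) t).hasDerivAt

theorem deriv_smoothStep_eq_zero {t : ℝ} (ht : t ∉ Icc (1 / 4 : ℝ) (3 / 4)) :
    deriv smoothStep t = 0 := by
  rw [mem_Icc, not_and_or, not_le, not_le] at ht
  rcases ht with ht | ht
  · have : smoothStep =ᶠ[nhds t] fun _ => 0 := by
      filter_upwards [Iio_mem_nhds ht] with s hs using smoothStep_of_le (le_of_lt hs)
    rw [this.deriv_eq, deriv_const]
  · have : smoothStep =ᶠ[nhds t] fun _ => 1 := by
      filter_upwards [Ioi_mem_nhds ht] with s hs using smoothStep_of_ge (le_of_lt hs)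
    rw [this.deriv_eq, deriv_const]

theorem hasCompactSupport_deriv_smoothStep : HasCompactSupport (deriv smoothStep) :=
  HasCompactSupport.intro isCompact_Icc fun _ => deriv_smoothStep_eq_zero

theorem exists_deriv_smoothStep_bound : ∃ M : ℝ, 1 ≤ M ∧ ∀ t, |deriv smoothStep t| ≤ M := by
  obtain ⟨M, hM⟩ := hasCompactSupport_deriv_smoothStep.exists_bound_of_continuous
    contDiff_deriv_smoothStep.continuous
  exact ⟨max M 1, le_max_right _ _, fun t => (hM t).trans (le_max_left _ _)⟩

/-- A bound, at least one, for the derivative of `smoothStep`. -/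
noncomputable def bumpBound : ℝ := exists_deriv_smoothStep_bound.choose

theorem one_le_bumpBound : 1 ≤ bumpBound := exists_deriv_smoothStep_bound.choose_spec.1

theorem abs_dyadicBump_le (k i : ℕ) (t : ℝ) : |dyadicBump k i t| ≤ 2 ^ k * bumpBound := by
  rw [dyadicBump, abs_mul, abs_of_nonneg (by positivity : (0 : ℝ) ≤ 2 ^ k)]
  gcongr
  exact exists_deriv_smoothStep_bound.choose_spec.2 _

theorem abs_dyadicPrimitive_le (k j : ℕ) (t : ℝ) : |dyadicPrimitive k j t| ≤ 1 := by
  have h0 : ∀ s, 0 ≤ smoothStep s := fun s => Real.smoothTransition.nonneg _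
  have h1 : ∀ s, smoothStep s ≤ 1 := fun s => Real.smoothTransition.le_one _
  rw [dyadicPrimitive, abs_le]
  constructor <;> linarith [h0 (2 ^ k * t - (j / 2 : ℕ)), h1 (2 ^ k * t - (j / 2 : ℕ)),
    h0 (2 ^ (k + 1) * t - j), h1 (2 ^ (k + 1) * t - j)]

theorem contDiff_dyadicBump (k i : ℕ) : ContDiff ℝ ∞ (dyadicBump k i) :=
  contDiff_const.mul (contDiff_deriv_smoothStep.comp (by fun_prop))

theorem contDiff_dyadicPrimitive (k j : ℕ) : ContDiff ℝ ∞ (dyadicPrimitive k j) :=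
  (contDiff_smoothStep.comp (by fun_prop)).sub (contDiff_smoothStep.comp (by fun_prop))

theorem hasDerivAt_smoothStep_dyadic (k i : ℕ) (t : ℝ) :
    HasDerivAt (fun t => smoothStep (2 ^ k * t - i)) (dyadicBump k i t) t := by
  have h1 : HasDerivAt (fun t : ℝ => 2 ^ k * t - i) (2 ^ k * 1) t :=
    ((hasDerivAt_id t).const_mul _).sub_const _
  have := (hasDerivAt_smoothStep (2 ^ k * t - i)).comp t h1
  rw [mul_one, mul_comm] at this
  exact this

theorem deriv_dyadicPrimitive (k j : ℕ) (t : ℝ) :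
    deriv (dyadicPrimitive k j) t = dyadicBump k (j / 2) t - dyadicBump (k + 1) j t :=
  ((hasDerivAt_smoothStep_dyadic k (j / 2) t).sub
    (hasDerivAt_smoothStep_dyadic (k + 1) j t)).deriv

/-- The compact subinterval of the open dyadic interval of index `i` at level `k`
that supports all bumps and primitives attached to it. -/
def dyadicCore (k i : ℕ) : Set ℝ := {t | 2 ^ k * t - i ∈ Icc (1 / 8 : ℝ) (7 / 8)}

theorem dyadicCore_eq_Icc (k i : ℕ) :
    dyadicCore k i = Icc (((i : ℝ) + 1 / 8) / 2 ^ k) (((i : ℝ) + 7 / 8) / 2 ^ k) := by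
  have hk : (0 : ℝ) < 2 ^ k := by positivity
  ext t
  simp only [dyadicCore, mem_ofPred_eq, mem_Icc, div_le_iff₀ hk, le_div_iff₀ hk]
  constructor <;> rintro ⟨h1, h2⟩ <;> constructor <;> linarith

theorem isCompact_dyadicCore (k i : ℕ) : IsCompact (dyadicCore k i) := by
  rw [dyadicCore_eq_Icc]
  exact isCompact_Icc

theorem floor_of_mem_dyadicCore {k i : ℕ} {t : ℝ} (ht : t ∈ dyadicCore k i) :
    ⌊2 ^ k * t⌋₊ = i := by
  obtain ⟨h1, h2⟩ := ht
  have hi : (0 : ℝ) ≤ i := by positivity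
  exact (Nat.floor_eq_iff (by linarith)).2 ⟨by linarith, by linarith⟩

theorem mem_Ioo_of_mem_dyadicCore {k i : ℕ} {t : ℝ} (hi : i < 2 ^ k) (ht : t ∈ dyadicCore k i) :
    0 < t ∧ t < 1 := by
  obtain ⟨h1, h2⟩ := ht
  have h0 : (0 : ℝ) ≤ i := by positivity
  have hk : (0 : ℝ) < 2 ^ k := by positivity
  have h3 : (i : ℝ) + 1 ≤ 2 ^ k := by exact_mod_cast hi
  constructor
  · exact pos_of_mul_pos_right (a := (2 : ℝ) ^ k) (by linarith) hk.le
  · by_contra! h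
    nlinarith

theorem dyadicBump_eq_zero {k i : ℕ} {t : ℝ} (ht : t ∉ dyadicCore k i) :
    dyadicBump k i t = 0 := by
  rw [dyadicBump, deriv_smoothStep_eq_zero, mul_zero]
  exact fun h => ht ⟨by linarith [h.1], by linarith [h.2]⟩

theorem dyadicBump_succ_eq_zero {k j : ℕ} {t : ℝ} (ht : t ∉ dyadicCore k (j / 2)) :
    dyadicBump (k + 1) j t = 0 := by
  rw [dyadicBump, deriv_smoothStep_eq_zero, mul_zero]
  intro h
  have h1 : 2 * (j / 2) ≤ j := Nat.mul_div_le j 2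
  have h2 : j ≤ 2 * (j / 2) + 1 := by omega
  have h1' : (2 : ℝ) * (j / 2 : ℕ) ≤ j := by exact_mod_cast h1
  have h2' : (j : ℝ) ≤ 2 * (j / 2 : ℕ) + 1 := by exact_mod_cast h2
  rw [pow_succ] at h
  exact ht ⟨by linarith [h.1], by linarith [h.2]⟩

theorem dyadicPrimitive_eq_zero {k j : ℕ} {t : ℝ} (ht : t ∉ dyadicCore k (j / 2)) :
    dyadicPrimitive k j t = 0 := by
  have h1 : 2 * (j / 2) ≤ j := Nat.mul_div_le j 2
  have h2 : j ≤ 2 * (j / 2) + 1 := by omega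
  have h1' : (2 : ℝ) * (j / 2 : ℕ) ≤ j := by exact_mod_cast h1
  have h2' : (j : ℝ) ≤ 2 * (j / 2 : ℕ) + 1 := by exact_mod_cast h2
  have h3 : (2 : ℝ) ^ (k + 1) * t = 2 * (2 ^ k * t) := by rw [pow_succ]; ring
  rw [dyadicCore, mem_ofPred_eq, mem_Icc, not_and_or, not_le, not_le] at ht
  rw [dyadicPrimitive, h3]
  rcases ht with ht | ht
  · rw [smoothStep_of_le (by linarith), smoothStep_of_le (by linarith), sub_zero]
  · rw [smoothStep_of_ge (by linarith), smoothStep_of_ge (by linarith), sub_self]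

theorem integral_dyadicBump (k i : ℕ) : ∫ t, dyadicBump k i t = 1 := by
  have hk : (0 : ℝ) < 2 ^ k := by positivity
  have hc : Continuous (dyadicBump k i) := (contDiff_dyadicBump k i).continuous
  have hs : HasCompactSupport (dyadicBump k i) :=
    HasCompactSupport.intro (isCompact_dyadicCore k i) fun _ => dyadicBump_eq_zero
  have hlim : ∀ {l : Filter ℝ} {c : ℝ}, (∀ᶠ t in l, smoothStep (2 ^ k * t - i) = c) →
      Filter.Tendsto (fun t => smoothStep (2 ^ k * t - i)) l (nhds c) := fun h =>
    tendsto_const_nhds.congr' (h.mono fun _ h => h.symm)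
  rw [integral_of_hasDerivAt_of_tendsto (hasDerivAt_smoothStep_dyadic k i)
    (hc.integrable_of_hasCompactSupport hs) (m := 0) (n := 1), sub_zero]
  · refine hlim ?_
    filter_upwards [Filter.eventually_le_atBot ((i : ℝ) / 2 ^ k)] with t ht
    rw [le_div_iff₀ hk] at ht
    exact smoothStep_of_le (by linarith)
  · refine hlim ?_
    filter_upwards [Filter.eventually_ge_atTop (((i : ℝ) + 1) / 2 ^ k)] with t ht
    rw [div_le_iff₀ hk] at ht
    exact smoothStep_of_ge (by linarith)

/-! ### Smooth cell averages and weak gradients -/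

/-- The tensor product of two functions of one variable. -/
def planeTensor (u w : ℝ → ℝ) (x : Plane) : ℝ := u (x 0) * w (x 1)

/-- The compact subset of the dyadic square of index `z` that supports all test functions
attached to it. -/
def squareCore (k : ℕ) (z : ℕ × ℕ) : Set Plane :=
  {x | x 0 ∈ dyadicCore k z.1 ∧ x 1 ∈ dyadicCore k z.2}

theorem isCompact_squareCore (k : ℕ) (z : ℕ × ℕ) : IsCompact (squareCore k z) := by
  have h : IsCompact (univ.pi ![dyadicCore k z.1, dyadicCore k z.2]) :=
    isCompact_univ_pi fun i => by
      fin_cases i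
      · exact isCompact_dyadicCore k z.1
      · exact isCompact_dyadicCore k z.2
  convert (EuclideanSpace.equiv (Fin 2) ℝ).toHomeomorph.isCompact_preimage.2 h using 1
  ext x
  simp [squareCore, Fin.forall_fin_two]

theorem squareCore_subset_dyadicCell {k : ℕ} {z : ℕ × ℕ} (hz : z.1 < 2 ^ k ∧ z.2 < 2 ^ k) :
    squareCore k z ⊆ dyadicCell k z := by
  rintro x ⟨h0, h1⟩
  obtain ⟨a0, b0⟩ := mem_Ioo_of_mem_dyadicCore hz.1 h0
  obtain ⟨a1, b1⟩ := mem_Ioo_of_mem_dyadicCore hz.2 h1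
  exact ⟨⟨a0, b0, a1, b1⟩,
    Prod.ext (floor_of_mem_dyadicCore h0) (floor_of_mem_dyadicCore h1)⟩

theorem planeTensor_eq_zero {k : ℕ} {z : ℕ × ℕ} {u w : ℝ → ℝ}
    (hu : ∀ t ∉ dyadicCore k z.1, u t = 0) (hw : ∀ t ∉ dyadicCore k z.2, w t = 0)
    {x : Plane} (hx : x ∉ squareCore k z) : planeTensor u w x = 0 := by
  by_cases h : x 0 ∈ dyadicCore k z.1
  · rw [planeTensor, hw _ fun h' => hx ⟨h, h'⟩, mul_zero]
  · rw [planeTensor, hu _ h, zero_mul]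

theorem contDiff_planeTensor {u w : ℝ → ℝ} (hu : ContDiff ℝ ∞ u) (hw : ContDiff ℝ ∞ w) :
    ContDiff ℝ ∞ (planeTensor u w) := by
  have h : ∀ i : Fin 2, ContDiff ℝ ∞ fun x : Plane => x i := fun i =>
    (EuclideanSpace.proj (𝕜 := ℝ) i).contDiff
  exact (hu.comp (h 0)).mul (hw.comp (h 1))

theorem hasFDerivAt_planeTensor {u w : ℝ → ℝ} (hu : Differentiable ℝ u) (hw : Differentiable ℝ w)
    (x : Plane) : HasFDerivAt (planeTensor u w)
      (u (x 0) • deriv w (x 1) • (EuclideanSpace.proj (𝕜 := ℝ) 1 : Plane →L[ℝ] ℝ)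
        + w (x 1) • deriv u (x 0) • (EuclideanSpace.proj (𝕜 := ℝ) 0 : Plane →L[ℝ] ℝ)) x := by
  have h : ∀ i : Fin 2, HasFDerivAt (fun x : Plane => x i)
      (EuclideanSpace.proj (𝕜 := ℝ) i : Plane →L[ℝ] ℝ) x := fun i =>
    (EuclideanSpace.proj (𝕜 := ℝ) i).hasFDerivAt
  exact ((hu (x 0)).hasDerivAt.comp_hasFDerivAt x (h 0)).mul
    ((hw (x 1)).hasDerivAt.comp_hasFDerivAt x (h 1))

theorem IsL2Loc.integrableOn_compact {f : Plane → ℝ} (hf : IsL2Loc unitSquare f) {K : Set Plane}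
    (hK : IsCompact K) (hKQ : K ⊆ unitSquare) : IntegrableOn f K := by
  have : IsFiniteMeasure (volume.restrict K) := ⟨by simpa using hK.measure_lt_top⟩
  exact (hf K hKQ hK).integrable one_le_two

section Tensor

variable {k : ℕ} {z : ℕ × ℕ} {u w : ℝ → ℝ}

theorem integrableOn_mul_planeTensor {f : Plane → ℝ} (hf : IsL2Loc unitSquare f)
    (hz : z.1 < 2 ^ k ∧ z.2 < 2 ^ k) (hu : Continuous u) (hw : Continuous w)
    (hu0 : ∀ t ∉ dyadicCore k z.1, u t = 0) (hw0 : ∀ t ∉ dyadicCore k z.2, w t = 0) :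
    IntegrableOn (fun x => f x * planeTensor u w x) unitSquare := by
  have hc : Continuous (planeTensor u w) :=
    (hu.comp (by fun_prop)).mul (hw.comp (by fun_prop))
  have hK : squareCore k z ⊆ unitSquare :=
    (squareCore_subset_dyadicCell hz).trans (dyadicCell_subset_unitSquare k z)
  refine IntegrableOn.of_forall_sdiff_eq_zero
    ((hf.integrableOn_compact (isCompact_squareCore k z) hK).mul_continuousOn hc.continuousOn
      (isCompact_squareCore k z)) measurableSet_unitSquare ?_
  rintro x ⟨-, hx⟩
  simp only [planeTensor_eq_zero hu0 hw0 hx, mul_zero]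

/-- The weak gradient tested against a tensor product supported in one dyadic square. -/
theorem HasWeakGradient.integral_planeTensor {f : Plane → ℝ} {g : Plane → Plane}
    (hg : HasWeakGradient unitSquare f g) (hz : z.1 < 2 ^ k ∧ z.2 < 2 ^ k)
    (hu : ContDiff ℝ ∞ u) (hw : ContDiff ℝ ∞ w)
    (hu0 : ∀ t ∉ dyadicCore k z.1, u t = 0) (hw0 : ∀ t ∉ dyadicCore k z.2, w t = 0) :
    (∫ x in unitSquare, f x * planeTensor (deriv u) w x
      = -∫ x in unitSquare, g x 0 * planeTensor u w x) ∧
    (∫ x in unitSquare, f x * planeTensor u (deriv w) x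
      = -∫ x in unitSquare, g x 1 * planeTensor u w x) := by
  have hcs : tsupport (planeTensor u w) ⊆ squareCore k z :=
    closure_minimal (fun x hx => by
      by_contra h
      exact hx (planeTensor_eq_zero hu0 hw0 h)) (isCompact_squareCore k z).isClosed
  have key := hg.integral_eq (planeTensor u w) (contDiff_planeTensor hu hw)
    ((isCompact_squareCore k z).of_isClosed_subset (isClosed_tsupport _) hcs)
    (hcs.trans ((squareCore_subset_dyadicCell hz).trans (dyadicCell_subset_unitSquare k z)))
  have hd := fun x => (hasFDerivAt_planeTensor (hu.differentiable (by simp))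
    (hw.differentiable (by simp)) x).fderiv
  constructor
  · rw [← key 0]
    congr 1 with x
    rw [hd x]
    simp [planeTensor, mul_comm]
  · rw [← key 1]
    congr 1 with x
    rw [hd x]
    simp [planeTensor]

/-- In the plane the `L²` norm of the gradient controls, uniformly in the scale, its integral
against a function of size `2ᵏ` supported in a square of side `2⁻ᵏ`. -/
theorem enorm_integral_mul_planeTensor_le {g : Plane → Plane}
    (hg : AEStronglyMeasurable g (volume.restrict unitSquare)) (i : Fin 2)
    (hz : z.1 < 2 ^ k ∧ z.2 < 2 ^ k) {M : ℝ} (hM : 0 ≤ M)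
    (hu0 : ∀ t ∉ dyadicCore k z.1, u t = 0) (hw0 : ∀ t ∉ dyadicCore k z.2, w t = 0)
    (hb : ∀ x, |planeTensor u w x| ≤ 2 ^ k * M) :
    ‖∫ x in unitSquare, g x i * planeTensor u w x‖ₑ
      ≤ ENNReal.ofReal M * (∫⁻ x in dyadicCell k z, ‖g x‖ₑ ^ 2) ^ (1 / 2 : ℝ) := by
  have hgm : AEMeasurable (fun x => ‖g x‖ₑ) (volume.restrict (dyadicCell k z)) :=
    (hg.mono_measure (Measure.restrict_mono (dyadicCell_subset_unitSquare k z) le_rfl)).enorm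
  have hCS : ∫⁻ x in dyadicCell k z, ‖g x‖ₑ
      ≤ (∫⁻ x in dyadicCell k z, ‖g x‖ₑ ^ 2) ^ (1 / 2 : ℝ) * ENNReal.ofReal ((1 / 2) ^ k) := by
    have h := ENNReal.lintegral_mul_le_Lp_mul_Lq (volume.restrict (dyadicCell k z))
      Real.HolderConjugate.two_two hgm (aemeasurable_const (b := (1 : ℝ≥0∞)))
    simp only [Pi.mul_apply, mul_one, ENNReal.rpow_ofNat, one_pow, lintegral_one,
      Measure.restrict_apply_univ] at h
    refine h.trans ?_
    gcongr
    calc volume (dyadicCell k z) ^ (1 / 2 : ℝ)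
        ≤ ENNReal.ofReal ((1 / 4) ^ k) ^ (1 / 2 : ℝ) := by
          gcongr
          exact volume_dyadicCell_le k z
      _ = ENNReal.ofReal ((1 / 2) ^ k) := by
          rw [ENNReal.ofReal_rpow_of_nonneg (by positivity) (by norm_num), ← Real.sqrt_eq_rpow]
          congr 1
          rw [Real.sqrt_eq_iff_mul_self_eq (by positivity) (by positivity), ← mul_pow]
          norm_num
  calc ‖∫ x in unitSquare, g x i * planeTensor u w x‖ₑ
      ≤ ∫⁻ x in unitSquare, ‖g x i * planeTensor u w x‖ₑ := enorm_integral_le_lintegral_enorm _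
    _ ≤ ∫⁻ x in unitSquare, (dyadicCell k z).indicator
          (fun x => ENNReal.ofReal (2 ^ k * M) * ‖g x‖ₑ) x := by
        refine lintegral_mono fun x => ?_
        by_cases hx : x ∈ dyadicCell k z
        · rw [indicator_of_mem hx, enorm_mul, mul_comm]
          gcongr
          · rw [← ofReal_norm, Real.norm_eq_abs]
            exact ENNReal.ofReal_le_ofReal (hb x)
          · exact enorm_le_iff_norm_le.2 (PiLp.norm_apply_le (g x) i)
        · rw [planeTensor_eq_zero hu0 hw0 fun h => hx (squareCore_subset_dyadicCell hz h)]
          simp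
    _ = ENNReal.ofReal (2 ^ k * M) * ∫⁻ x in dyadicCell k z, ‖g x‖ₑ := by
        rw [setLIntegral_indicator (measurableSet_dyadicCell k z),
          inter_eq_left.2 (dyadicCell_subset_unitSquare k z), lintegral_const_mul'' _ hgm]
    _ ≤ ENNReal.ofReal (2 ^ k * M) * ((∫⁻ x in dyadicCell k z, ‖g x‖ₑ ^ 2) ^ (1 / 2 : ℝ)
          * ENNReal.ofReal ((1 / 2) ^ k)) := by gcongr
    _ = ENNReal.ofReal M * (∫⁻ x in dyadicCell k z, ‖g x‖ₑ ^ 2) ^ (1 / 2 : ℝ) := by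
        rw [mul_left_comm, ← ENNReal.ofReal_mul (by positivity), mul_comm]
        congr 2
        rw [mul_right_comm, ← mul_pow]
        norm_num

end Tensor

/-- The average of `f` over the dyadic square of side `2⁻ᵏ` with index `z` against a smooth
bump supported in the interior of the square; this makes sense for locally integrable `f`
even if the square touches the boundary of the unit square. -/
noncomputable def cellMean (f : Plane → ℝ) (k : ℕ) (z : ℕ × ℕ) : ℝ :=
  ∫ x in unitSquare, f x * planeTensor (dyadicBump k z.1) (dyadicBump k z.2) x

theorem IsL2Loc.integrableOn_mul_bump {f : Plane → ℝ} (hf : IsL2Loc unitSquare f) {k : ℕ}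
    {z : ℕ × ℕ} (hz : z.1 < 2 ^ k ∧ z.2 < 2 ^ k) :
    IntegrableOn (fun x => f x * planeTensor (dyadicBump k z.1) (dyadicBump k z.2) x)
      unitSquare :=
  integrableOn_mul_planeTensor hf hz (contDiff_dyadicBump k z.1).continuous
    (contDiff_dyadicBump k z.2).continuous (fun _ => dyadicBump_eq_zero)
    (fun _ => dyadicBump_eq_zero)

/-- The difference of the averages over a dyadic square and one of its children is the integral
of the weak gradient against an explicit smooth field, built from the primitives of the
differences of one-dimensional bumps. -/
theorem enorm_cellMean_sub_le {f : Plane → ℝ} {g : Plane → Plane} (hf : IsL2Loc unitSquare f)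
    (hg : HasWeakGradient unitSquare f g)
    (hgm : AEStronglyMeasurable g (volume.restrict unitSquare)) {k : ℕ} {z : ℕ × ℕ}
    (hz : z.1 < 2 ^ (k + 1) ∧ z.2 < 2 ^ (k + 1)) :
    ‖cellMean f (k + 1) z - cellMean f k (dyadicParent z)‖ₑ ≤
      ENNReal.ofReal (4 * bumpBound)
        * (∫⁻ x in dyadicCell k (dyadicParent z), ‖g x‖ₑ ^ 2) ^ (1 / 2 : ℝ) := by
  have hB := one_le_bumpBound
  have hp : (dyadicParent z).1 < 2 ^ k ∧ (dyadicParent z).2 < 2 ^ k := by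
    simp only [dyadicParent, pow_succ] at hz ⊢
    omega
  have hb : ∀ i, ∀ t ∉ dyadicCore k i, dyadicBump k i t = 0 := fun i t => dyadicBump_eq_zero
  have hb' : ∀ j, ∀ t ∉ dyadicCore k (j / 2), dyadicBump (k + 1) j t = 0 :=
    fun j t => dyadicBump_succ_eq_zero
  have hq : ∀ j, ∀ t ∉ dyadicCore k (j / 2), dyadicPrimitive k j t = 0 :=
    fun j t => dyadicPrimitive_eq_zero
  have i1 := integrableOn_mul_planeTensor hf hp
    ((contDiff_infty_iff_deriv.1 (contDiff_dyadicPrimitive k z.1)).2.continuous)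
    (contDiff_dyadicBump k (z.2 / 2)).continuous
    (fun t ht => by
      rw [deriv_dyadicPrimitive, hb (z.1 / 2) t ht, hb' _ t ht, sub_zero]) (hb _)
  have i2 := integrableOn_mul_planeTensor hf hp
    (contDiff_dyadicBump (k + 1) z.1).continuous
    ((contDiff_infty_iff_deriv.1 (contDiff_dyadicPrimitive k z.2)).2.continuous) (hb' _)
    (fun t ht => by
      rw [deriv_dyadicPrimitive, hb (z.2 / 2) t ht, hb' _ t ht, sub_zero])
  have e1 := (hg.integral_planeTensor hp (contDiff_dyadicPrimitive k z.1)
    (contDiff_dyadicBump k (z.2 / 2)) (hq _) (hb _)).1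
  have e2 := (hg.integral_planeTensor hp (contDiff_dyadicBump (k + 1) z.1)
    (contDiff_dyadicPrimitive k z.2) (hb' _) (hq _)).2
  have b1 := enorm_integral_mul_planeTensor_le hgm 0 hp (M := 2 * bumpBound) (by linarith)
    (hq z.1) (hb (z.2 / 2)) (fun x => by
      rw [planeTensor, abs_mul]
      calc _ ≤ 1 * (2 ^ k * bumpBound) :=
            mul_le_mul (abs_dyadicPrimitive_le _ _ _) (abs_dyadicBump_le _ _ _)
              (abs_nonneg _) zero_le_one
        _ ≤ _ := by
            have : (0 : ℝ) ≤ 2 ^ k * bumpBound := by positivity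
            linarith)
  have b2 := enorm_integral_mul_planeTensor_le hgm 1 hp (M := 2 * bumpBound) (by linarith)
    (hb' z.1) (hq z.2) (fun x => by
      rw [planeTensor, abs_mul]
      calc _ ≤ (2 ^ (k + 1) * bumpBound) * 1 :=
            mul_le_mul (abs_dyadicBump_le _ _ _) (abs_dyadicPrimitive_le _ _ _)
              (abs_nonneg _) (by positivity)
        _ = _ := by ring)
  have hdiff : cellMean f (k + 1) z - cellMean f k (dyadicParent z)
      = (∫ x in unitSquare, g x 0 * planeTensor (dyadicPrimitive k z.1)
          (dyadicBump k (z.2 / 2)) x)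
        + ∫ x in unitSquare, g x 1 * planeTensor (dyadicBump (k + 1) z.1)
          (dyadicPrimitive k z.2) x := by
    have h : cellMean f k (dyadicParent z) - cellMean f (k + 1) z
        = (∫ x in unitSquare, f x * planeTensor (deriv (dyadicPrimitive k z.1))
            (dyadicBump k (z.2 / 2)) x)
          + ∫ x in unitSquare, f x * planeTensor (dyadicBump (k + 1) z.1)
            (deriv (dyadicPrimitive k z.2)) x := by
      rw [cellMean, cellMean, ← integral_sub (hf.integrableOn_mul_bump hp)
        (hf.integrableOn_mul_bump hz), ← integral_add i1 i2]
      congr 1 with x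
      simp only [planeTensor, deriv_dyadicPrimitive, dyadicParent]
      ring
    rw [e1, e2] at h
    linarith
  rw [hdiff]
  refine (enorm_add_le _ _).trans ((add_le_add b1 b2).trans (le_of_eq ?_))
  rw [← add_mul, ← ENNReal.ofReal_add (by linarith) (by linarith)]
  congr 2
  ring

/-! ### Convergence of the averages -/

theorem integral_planeTensor (u w : ℝ → ℝ) :
    ∫ x, planeTensor u w x = (∫ t, u t) * ∫ t, w t := by
  have h := (EuclideanSpace.volume_preserving_symm_measurableEquiv_toLp (Fin 2)).integral_comp'
    (fun y : Fin 2 → ℝ => ∏ i, ![u, w] i (y i))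
  rw [integral_fintype_prod_volume_eq_prod (fun i => ![u, w] i)] at h
  simpa [planeTensor, Fin.prod_univ_two] using h

theorem dist_le_of_dyadicIndex_eq {k : ℕ} {x y : Plane} (hx : x ∈ unitSquare)
    (hy : y ∈ unitSquare) (h : dyadicIndex k x = dyadicIndex k y) :
    dist x y ≤ 2 * (1 / 2) ^ k := by
  have hc : ∀ i : Fin 2, |x i - y i| ≤ (1 / 2) ^ k := fun i => by
    have key : ∀ s t : ℝ, 0 ≤ s → 0 ≤ t → ⌊2 ^ k * s⌋₊ = ⌊2 ^ k * t⌋₊ →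
        |s - t| ≤ (1 / 2) ^ k := fun s t hs ht hst => by
      have h1 := floor_mul_two_pow_bounds hs hst
      have h2 := floor_mul_two_pow_bounds (k := k) ht rfl
      rw [one_div_pow, abs_le]
      constructor <;> linarith
    obtain ⟨h0, h1⟩ := Prod.ext_iff.1 h
    fin_cases i
    · exact key _ _ hx.1.le hy.1.le h0
    · exact key _ _ hx.2.2.1.le hy.2.2.1.le h1
  rw [EuclideanSpace.dist_eq, Fin.sum_univ_two]
  refine Real.sqrt_le_iff.2 ⟨by positivity, ?_⟩
  have h0 := pow_le_pow_left₀ (abs_nonneg _) (hc 0) 2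
  have h1 := pow_le_pow_left₀ (abs_nonneg _) (hc 1) 2
  rw [Real.dist_eq, Real.dist_eq]
  nlinarith

/-- **Lebesgue differentiation** along the smooth averages over the dyadic squares
containing a point. -/
theorem ae_tendsto_cellMean {f : Plane → ℝ} (hf : IsL2Loc unitSquare f) :
    ∀ᵐ x ∂volume.restrict unitSquare,
      Filter.Tendsto (fun k => cellMean f k (dyadicIndex k x)) Filter.atTop (nhds (f x)) := by
  rw [ae_restrict_iff' measurableSet_unitSquare, ae_iff]
  refine measure_null_of_locally_null _ fun x₀ hx₀ => ?_
  rw [mem_ofPred_eq, Classical.not_imp] at hx₀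
  obtain ⟨r, hr, hball⟩ :=
    Metric.nhds_basis_closedBall.mem_iff.1 (isOpen_unitSquare.mem_nhds hx₀.1)
  refine ⟨_, inter_mem_nhdsWithin _ (Metric.ball_mem_nhds x₀ hr), ?_⟩
  -- Near `x₀` the function `f` agrees with an integrable function on the whole plane.
  set F : Plane → ℝ := (Metric.closedBall x₀ r).indicator f with hF
  have hFint : Integrable F := (integrable_indicator_iff Metric.isClosed_closedBall.measurableSet).2
    (hf.integrableOn_compact (isCompact_closedBall x₀ r) hball)
  have hδ : Filter.Tendsto (fun k : ℕ => 2 * (1 / 2 : ℝ) ^ k) Filter.atTop (nhdsWithin 0 (Ioi 0)) := by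
    refine tendsto_nhdsWithin_iff.2 ⟨?_, Filter.Eventually.of_forall fun k => by
      rw [mem_Ioi]; positivity⟩
    simpa using (tendsto_pow_atTop_nhds_zero_of_lt_one (r := (1 / 2 : ℝ)) (by norm_num)
      (by norm_num)).const_mul 2
  have hae := IsUnifLocDoublingMeasure.ae_tendsto_average_norm_sub volume
    hFint.locallyIntegrable 1
  rw [ae_iff] at hae
  refine measure_mono_null ?_ hae
  rintro x ⟨hx, hxr⟩
  rw [mem_ofPred_eq, Classical.not_imp] at hx
  obtain ⟨hxQ, hxn⟩ := hx
  intro hlim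
  apply hxn
  have hxF : F x = f x := indicator_of_mem (Metric.ball_subset_closedBall hxr) f
  have hlt : ∀ k, (dyadicIndex k x).1 < 2 ^ k ∧ (dyadicIndex k x).2 < 2 ^ k :=
    fun k => dyadicIndex_lt hxQ
  have hzero : ∀ k, ∀ y ∉ dyadicCell k (dyadicIndex k x),
      planeTensor (dyadicBump k (dyadicIndex k x).1) (dyadicBump k (dyadicIndex k x).2) y = 0 :=
    fun k y hy => planeTensor_eq_zero (fun _ => dyadicBump_eq_zero) (fun _ => dyadicBump_eq_zero)
      fun h => hy (squareCore_subset_dyadicCell (hlt k) h)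
  have hcell : ∀ k, dyadicCell k (dyadicIndex k x) ⊆ Metric.closedBall x (2 * (1 / 2) ^ k) :=
    fun k y hy => dist_le_of_dyadicIndex_eq hy.1 hxQ hy.2
  have hsmall : ∀ᶠ k : ℕ in Filter.atTop,
      Metric.closedBall x (2 * (1 / 2) ^ k) ⊆ Metric.closedBall x₀ r := by
    have h1 : Metric.closedBall x₀ r ∈ nhds x :=
      Filter.mem_of_superset (Metric.isOpen_ball.mem_nhds hxr) Metric.ball_subset_closedBall
    obtain ⟨ε, hε, hsub⟩ := Metric.nhds_basis_closedBall.mem_iff.1 h1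
    filter_upwards [(tendsto_nhdsWithin_iff.1 hδ).1.eventually (ge_mem_nhds hε)] with k hk
    exact (Metric.closedBall_subset_closedBall hk).trans hsub
  have key := tendsto_integral_smul_of_tendsto_average_norm_sub (μ := volume)
    (a := fun k : ℕ => Metric.closedBall x (2 * (1 / 2) ^ k)) (f := F) (c := F x)
    (g := fun k => planeTensor (dyadicBump k (dyadicIndex k x).1)
      (dyadicBump k (dyadicIndex k x).2))
    (4 * bumpBound ^ 2 * (volume : Measure Plane).real (Metric.ball 0 1))
    (hlim (fun _ => x) _ hδ (Filter.Eventually.of_forall fun k =>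
      Metric.mem_closedBall_self (by positivity)))
    (Filter.Eventually.of_forall fun k => hFint.integrableOn) ?_
    (Filter.Eventually.of_forall fun k y hy => hcell k (by
      by_contra h
      exact hy (hzero k y h))) ?_
  · rw [hxF] at key
    refine key.congr' ?_
    filter_upwards [hsmall] with k hk
    rw [cellMean, ← setIntegral_eq_integral_of_forall_compl_eq_zero (s := unitSquare)]
    · refine integral_congr_ae (Filter.Eventually.of_forall fun y => ?_)
      by_cases hy : y ∈ dyadicCell k (dyadicIndex k x)
      · simp only [smul_eq_mul, hF, indicator_of_mem (hk (hcell k hy)), mul_comm]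
      · simp only [hzero k y hy, zero_smul, mul_zero]
    · intro y hy
      rw [hzero k y fun h => hy h.1, zero_smul]
  · simp only [integral_planeTensor, integral_dyadicBump, mul_one]
    exact tendsto_const_nhds
  · refine Filter.Eventually.of_forall fun k y => ?_
    have hω : 0 < (volume : Measure Plane).real (Metric.ball 0 1) :=
      ENNReal.toReal_pos (Metric.measure_ball_pos _ _ one_pos).ne' measure_ball_lt_top.ne
    have hvol : (volume : Measure Plane).real (Metric.closedBall x (2 * (1 / 2) ^ k))
        = 4 * (1 / 4) ^ k * (volume : Measure Plane).real (Metric.ball 0 1) := by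
      rw [Measure.addHaar_real_closedBall _ _ (by positivity), finrank_euclideanSpace_fin, mul_pow,
        ← pow_mul, mul_comm k 2, pow_mul]
      norm_num
    have hb : |planeTensor (dyadicBump k (dyadicIndex k x).1)
        (dyadicBump k (dyadicIndex k x).2) y| ≤ (2 ^ k * bumpBound) * (2 ^ k * bumpBound) := by
      rw [planeTensor, abs_mul]
      exact mul_le_mul (abs_dyadicBump_le _ _ _) (abs_dyadicBump_le _ _ _) (abs_nonneg _)
        (mul_nonneg (by positivity) (zero_le_one.trans one_le_bumpBound))
    refine hb.trans (le_of_eq ?_)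
    rw [hvol, eq_div_iff (by positivity)]
    have h4 : (2 : ℝ) ^ k * 2 ^ k * (1 / 4) ^ k = 1 := by
      rw [← mul_pow, ← mul_pow]
      norm_num
    linear_combination 4 * bumpBound ^ 2 * (volume : Measure Plane).real (Metric.ball 0 1) * h4

/-! ### Summation along chains of dyadic squares -/

/-- A geometrically decreasing sequence, summed over its terms below the threshold `d`, is
at most `d` times the geometric series, no matter when the threshold is passed. -/
theorem tsum_ite_le_of_geometric (r d : ℝ≥0∞) (u : ℕ → ℝ≥0∞) (hu : ∀ k, u (k + 1) ≤ r * u k) :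
    ∑' k, (if u k ≤ d then u k else 0) ≤ d * (1 - r)⁻¹ := by
  refine ENNReal.tsum_le_of_sum_range_le fun n => ?_
  induction n generalizing u with
  | zero => simp
  | succ n ih =>
    by_cases h0 : u 0 ≤ d
    · have hk : ∀ k, u k ≤ d * r ^ k := fun k => by
        induction k with
        | zero => simpa using h0
        | succ k ihk =>
          calc u (k + 1) ≤ r * u k := hu k
            _ ≤ r * (d * r ^ k) := by gcongr
            _ = d * r ^ (k + 1) := by ring
      calc ∑ k ∈ Finset.range (n + 1), (if u k ≤ d then u k else 0)
          ≤ ∑ k ∈ Finset.range (n + 1), d * r ^ k := Finset.sum_le_sum fun k _ => by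
            split_ifs
            · exact hk k
            · exact zero_le
        _ ≤ ∑' k, d * r ^ k := ENNReal.sum_le_tsum _
        _ = d * (1 - r)⁻¹ := by rw [ENNReal.tsum_mul_left, ENNReal.tsum_geometric]
    · rw [Finset.sum_range_succ', if_neg h0, add_zero]
      exact ih (fun k => u (k + 1)) fun k => hu (k + 1)

/-- The weighted **Cauchy–Schwarz inequality** for series. -/
theorem sq_tsum_le_tsum_mul_tsum_div {b w : ℕ → ℝ≥0∞} (h0 : ∀ k, w k = 0 → b k = 0)
    (ht : ∀ k, w k ≠ ⊤) : (∑' k, b k) ^ 2 ≤ (∑' k, w k) * ∑' k, b k ^ 2 / w k := by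
  have hfin : ∑' k, b k ≤ ((∑' k, w k) * ∑' k, b k ^ 2 / w k) ^ (1 / 2 : ℝ) := by
    refine ENNReal.tsum_le_of_sum_range_le fun n => ?_
    have hsq : ∀ x : ℝ≥0∞, (x ^ (1 / 2 : ℝ)) ^ 2 = x := fun x => by
      rw [← ENNReal.rpow_natCast, ← ENNReal.rpow_mul]
      norm_num
    have hterm : ∀ k, b k = w k ^ (1 / 2 : ℝ) * (b k ^ 2 / w k) ^ (1 / 2 : ℝ) := fun k => by
      rcases eq_or_ne (w k) 0 with hw | hw
      · simp [h0 k hw, hw]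
      · rw [← ENNReal.mul_rpow_of_nonneg _ _ (by norm_num), ENNReal.mul_div_cancel hw (ht k),
          ← ENNReal.rpow_natCast, ← ENNReal.rpow_mul]
        norm_num
    have h := ENNReal.inner_le_Lp_mul_Lq (Finset.range n) (fun k => w k ^ (1 / 2 : ℝ))
      (fun k => (b k ^ 2 / w k) ^ (1 / 2 : ℝ)) Real.HolderConjugate.two_two
    simp only [← hterm, ENNReal.rpow_ofNat, hsq] at h
    refine h.trans ?_
    rw [← ENNReal.mul_rpow_of_nonneg _ _ (by norm_num)]
    gcongr <;> exact ENNReal.sum_le_tsum _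
  calc (∑' k, b k) ^ 2 ≤ (((∑' k, w k) * ∑' k, b k ^ 2 / w k) ^ (1 / 2 : ℝ)) ^ 2 := by gcongr
    _ = _ := by
      rw [← ENNReal.rpow_natCast, ← ENNReal.rpow_mul]
      norm_num

/-- The weighted integral inequality behind the theorem. If `h` is bounded by the sum of
`B (∫_S G)^(1/2)` over the squares `S` containing the point whose weight is at most `d`,
where the weights decrease geometrically and their squares dominate `∫_S v`, then `∫ v h²` is
bounded by a multiple of `d² ∫ G`. The weights serve both as Cauchy–Schwarz weights and as
bounds for `∫_S v`, so that each `∫_S G` is counted with total weight `O(d)`. -/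
theorem lintegral_mul_sq_le_of_dyadic {v G h : Plane → ℝ≥0∞}
    (hv : AEMeasurable v (volume.restrict unitSquare))
    (hG : AEMeasurable G (volume.restrict unitSquare)) (u : ℕ → ℕ × ℕ → ℝ≥0∞) {r d B : ℝ≥0∞}
    (hd : d ≠ ⊤) (hu0 : ∀ k z, u k z ≠ 0)
    (hur : ∀ k z, u (k + 1) z ≤ r * u k (dyadicParent z))
    (huv : ∀ k z, ∫⁻ x in dyadicCell k z, v x ≤ u k z ^ 2)
    (hh : ∀ᵐ x ∂volume.restrict unitSquare, h x ≤ ∑' k, if u k (dyadicIndex k x) ≤ d then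
      B * (∫⁻ y in dyadicCell k (dyadicIndex k x), G y) ^ (1 / 2 : ℝ) else 0) :
    ∫⁻ x in unitSquare, v x * h x ^ 2 ≤
      (B * (d * (1 - r)⁻¹)) ^ 2 * ∫⁻ x in unitSquare, G x := by
  classical
  set M := d * (1 - r)⁻¹ with hM
  set a : ℕ → ℕ × ℕ → ℝ≥0∞ := fun k z => ∫⁻ y in dyadicCell k z, G y with ha
  set w : ℕ → ℕ × ℕ → ℝ≥0∞ := fun k z => if u k z ≤ d then u k z else 0 with hw
  have hwM : ∀ x, ∑' k, w k (dyadicIndex k x) ≤ M := fun x =>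
    tsum_ite_le_of_geometric r d (fun k => u k (dyadicIndex k x)) fun k => by
      have := hur k (dyadicIndex (k + 1) x)
      rwa [dyadicParent_dyadicIndex] at this
  set t : ℕ → ℕ × ℕ → ℝ≥0∞ := fun k z =>
    (if u k z ≤ d then B * a k z ^ (1 / 2 : ℝ) else 0) ^ 2 / w k z with ht
  have hmeas : ∀ (c : ℕ → ℕ × ℕ → ℝ≥0∞) (k : ℕ), Measurable fun x => c k (dyadicIndex k x) :=
    fun c k => (measurable_of_countable (c k)).comp (measurable_dyadicIndex k)
  have hmv : ∀ k, AEMeasurable (fun x => t k (dyadicIndex k x) * v x)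
      (volume.restrict unitSquare) := fun k => (hmeas t k).aemeasurable.mul hv
  have hmG : ∀ k, AEMeasurable (fun x => w k (dyadicIndex k x) * G x)
      (volume.restrict unitSquare) := fun k => (hmeas w k).aemeasurable.mul hG
  have ht_le : ∀ k z, t k z * ∫⁻ x in dyadicCell k z, v x ≤ B ^ 2 * (w k z * a k z) := by
    intro k z
    simp only [ht, hw]
    split_ifs with hg
    · have hut : u k z ≠ ⊤ := ne_top_of_le_ne_top hd hg
      calc (B * a k z ^ (1 / 2 : ℝ)) ^ 2 / u k z * ∫⁻ x in dyadicCell k z, v x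
          ≤ (B * a k z ^ (1 / 2 : ℝ)) ^ 2 / u k z * u k z ^ 2 := by
            gcongr
            exact huv k z
        _ = (B * a k z ^ (1 / 2 : ℝ)) ^ 2 * u k z := by
            rw [sq (u k z), ← mul_assoc, ENNReal.div_mul_cancel (hu0 k z) hut]
        _ = B ^ 2 * (u k z * a k z) := by
            rw [mul_pow, ← ENNReal.rpow_natCast (a k z ^ (1 / 2 : ℝ)), ← ENNReal.rpow_mul]
            norm_num
            ring
    · simp
  calc ∫⁻ x in unitSquare, v x * h x ^ 2
      ≤ ∫⁻ x in unitSquare, M * ∑' k, t k (dyadicIndex k x) * v x := by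
        refine lintegral_mono_ae ?_
        filter_upwards [hh] with x hx
        rw [ENNReal.tsum_mul_right, ← mul_assoc, mul_comm]
        gcongr
        refine (pow_le_pow_left' hx 2).trans
          ((sq_tsum_le_tsum_mul_tsum_div (w := fun k => w k (dyadicIndex k x)) ?_ ?_).trans
          (mul_le_mul_left (hwM x) _))
        · intro k hk
          by_cases hg : u k (dyadicIndex k x) ≤ d
          · simp only [hw, if_pos hg] at hk
            exact absurd hk (hu0 _ _)
          · exact if_neg hg
        · intro k
          simp only [hw]
          split_ifs with hg
          · exact ne_top_of_le_ne_top hd hg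
          · exact ENNReal.zero_ne_top
    _ = M * ∑' k, ∑' z, t k z * ∫⁻ x in dyadicCell k z, v x := by
        rw [lintegral_const_mul'' _ (AEMeasurable.tsum hmv), lintegral_tsum hmv]
        simp only [lintegral_dyadicIndex_mul _ _ hv]
    _ ≤ M * ∑' k, ∑' z, B ^ 2 * (w k z * a k z) := by
        gcongr M * ?_
        exact ENNReal.tsum_le_tsum fun k => ENNReal.tsum_le_tsum fun z => ht_le k z
    _ = M * (B ^ 2 * ∫⁻ x in unitSquare, (∑' k, w k (dyadicIndex k x)) * G x) := by
        simp only [ENNReal.tsum_mul_left, ← ENNReal.tsum_mul_right, ha,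
          ← lintegral_dyadicIndex_mul _ _ hG]
        rw [lintegral_tsum hmG]
    _ ≤ M * (B ^ 2 * ∫⁻ x in unitSquare, M * G x) := by
        gcongr with x
        exact hwM x
    _ = (B * M) ^ 2 * ∫⁻ x in unitSquare, G x := by
        rw [lintegral_const_mul'' _ hG]
        ring

/-! ### Weights and the number of heavy squares -/

/-- The dyadic scaling ratio `2^(-(1 - 1/p))` of the weights. -/
noncomputable def weightRatio (p : ℝ) : ℝ := (1 / 2) ^ (1 - 1 / p)

theorem weightRatio_pos (p : ℝ) : 0 < weightRatio p := Real.rpow_pos_of_pos (by norm_num) _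

theorem weightRatio_lt_one {p : ℝ} (hp : 1 < p) : weightRatio p < 1 :=
  Real.rpow_lt_one (by norm_num) (by norm_num) (by
    rw [sub_pos, div_lt_one (by linarith)]
    exact hp)

/-- The weight `(|S|^(1 - 1/p) ‖V‖_{L^p(S)})^(1/2)` of the dyadic square `S` of side `2⁻ᵏ` and
index `z`. -/
noncomputable def cellWeight (V : Plane → ℝ) (p : ℝ) (k : ℕ) (z : ℕ × ℕ) : ℝ≥0∞ :=
  eLpNorm V (ENNReal.ofReal p) (volume.restrict (dyadicCell k z)) ^ (1 / 2 : ℝ)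
    * ENNReal.ofReal (weightRatio p) ^ k

theorem cellWeight_sq (V : Plane → ℝ) (p : ℝ) (k : ℕ) (z : ℕ × ℕ) :
    cellWeight V p k z ^ 2 = eLpNorm V (ENNReal.ofReal p) (volume.restrict (dyadicCell k z))
      * ENNReal.ofReal (weightRatio p) ^ (2 * k) := by
  rw [cellWeight, mul_pow, ← pow_mul, mul_comm k, ← ENNReal.rpow_natCast (_ ^ (1 / 2 : ℝ)),
    ← ENNReal.rpow_mul]
  norm_num

theorem cellWeight_succ_le (V : Plane → ℝ) (p : ℝ) (k : ℕ) (z : ℕ × ℕ) :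
    cellWeight V p (k + 1) z ≤ ENNReal.ofReal (weightRatio p) * cellWeight V p k (dyadicParent z) := by
  rw [cellWeight, cellWeight, pow_succ, ← mul_assoc, mul_comm]
  gcongr
  exact dyadicCell_subset_parent k z

theorem lintegral_dyadicCell_le_cellWeight_sq {V : Plane → ℝ}
    (hV : AEStronglyMeasurable V (volume.restrict unitSquare)) {p : ℝ} (hp : 1 < p) (k : ℕ)
    (z : ℕ × ℕ) : ∫⁻ x in dyadicCell k z, ‖V x‖ₑ ≤ cellWeight V p k z ^ 2 := by
  have hβ : 0 ≤ 1 - 1 / p := by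
    rw [sub_nonneg, div_le_one (by linarith)]
    exact hp.le
  have h := eLpNorm_le_eLpNorm_mul_rpow_measure_univ (μ := volume.restrict (dyadicCell k z))
    (p := 1) (q := ENNReal.ofReal p) (f := V) (by simpa using hp.le)
    (hV.mono_measure (Measure.restrict_mono (dyadicCell_subset_unitSquare k z) le_rfl))
  rw [eLpNorm_one_eq_lintegral_enorm, Measure.restrict_apply_univ,
    ENNReal.toReal_ofReal (by linarith), ENNReal.toReal_one, div_one] at h
  rw [cellWeight_sq]
  refine h.trans ?_
  gcongr
  calc volume (dyadicCell k z) ^ (1 - 1 / p)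
      ≤ ENNReal.ofReal ((1 / 4) ^ k) ^ (1 - 1 / p) := by
        gcongr
        exact volume_dyadicCell_le k z
    _ = ENNReal.ofReal (weightRatio p) ^ (2 * k) := by
        rw [ENNReal.ofReal_rpow_of_nonneg (by positivity) hβ,
          ← ENNReal.ofReal_pow (weightRatio_pos p).le, weightRatio, ← Real.rpow_natCast,
          ← Real.rpow_natCast, ← Real.rpow_mul (by norm_num), ← Real.rpow_mul (by norm_num),
          show (1 / 4 : ℝ) = (1 / 2) ^ (2 : ℝ) by norm_num, ← Real.rpow_mul (by norm_num)]
        congr 2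
        push_cast
        ring

theorem tsum_eLpNorm_rpow_dyadicCell (V : Plane → ℝ) {p : ℝ} (hp : 0 < p) (k : ℕ) :
    ∑' z, eLpNorm V (ENNReal.ofReal p) (volume.restrict (dyadicCell k z)) ^ p
      = eLpNorm V (ENNReal.ofReal p) (volume.restrict unitSquare) ^ p := by
  have h : ∀ ν : Measure Plane, eLpNorm V (ENNReal.ofReal p) ν ^ p = ∫⁻ x, ‖V x‖ₑ ^ p ∂ν :=
    fun ν => by
      rw [eLpNorm_eq_lintegral_rpow_enorm_toReal (by simpa using hp) (by simp),
        ENNReal.toReal_ofReal hp.le, ← ENNReal.rpow_mul, one_div_mul_cancel hp.ne',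
        ENNReal.rpow_one]
  simp only [h]
  exact (lintegral_unitSquare_eq_tsum k _).symm

/-- If `n k ≤ min (4ᵏ) (Aᵖ 4^(-k(p-1)))` then the sum of the `n k` is linear in `A`: the two
bounds cross at `4ᵏ = A`, and the sum is dominated by that scale. -/
theorem exists_sum_le_of_le_pow (p : ℝ) (hp : 1 < p) :
    ∃ C : ℝ, 0 < C ∧ ∀ A : ℝ, 0 ≤ A → ∀ n : ℕ → ℝ, (∀ k, n k ≤ 4 ^ k) →
      (∀ k, n k ≤ A ^ p * ((1 / 4 : ℝ) ^ (p - 1)) ^ k) →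
      ∀ K, ∑ k ∈ Finset.range K, n k ≤ C * A := by
  set q : ℝ := (1 / 4 : ℝ) ^ (p - 1) with hq
  have hq0 : 0 < q := Real.rpow_pos_of_pos (by norm_num) _
  have hq1 : q < 1 := Real.rpow_lt_one (by norm_num) (by norm_num) (by linarith)
  refine ⟨4 + (1 - q)⁻¹, by have := inv_pos.2 (sub_pos.2 hq1); linarith, ?_⟩
  intro A hA n h1 h2 K
  rcases hA.eq_or_lt with rfl | hA
  · rw [mul_zero]
    refine Finset.sum_nonpos fun k _ => (h2 k).trans_eq ?_
    rw [Real.zero_rpow (by linarith), zero_mul]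
  obtain ⟨L, hL1, hL2⟩ : ∃ L : ℕ, A ≤ 4 ^ L ∧ ∑ k ∈ Finset.range L, (4 : ℝ) ^ k ≤ 4 * A := by
    rcases lt_or_ge A 1 with hA1 | hA1
    · exact ⟨0, by simpa using hA1.le, by simpa using hA.le⟩
    · obtain ⟨L, hL, hL'⟩ := exists_nat_pow_near hA1 (by norm_num : (1 : ℝ) < 4)
      refine ⟨L + 1, hL'.le, ?_⟩
      rw [geom_sum_eq (by norm_num), pow_succ]
      have : (0 : ℝ) ≤ 4 ^ L := by positivity
      linarith
  have hqL : A ^ p * q ^ L ≤ A := by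
    have h3 : q ^ L ≤ A ^ (-(p - 1)) := by
      calc q ^ L = ((4 : ℝ) ^ L) ^ (-(p - 1)) := by
            rw [hq, ← Real.rpow_natCast, ← Real.rpow_natCast, ← Real.rpow_mul (by norm_num),
              ← Real.rpow_mul (by norm_num), one_div, Real.inv_rpow (by norm_num),
              ← Real.rpow_neg (by norm_num)]
            congr 1
            ring
        _ ≤ A ^ (-(p - 1)) := Real.rpow_le_rpow_of_nonpos hA hL1 (by linarith)
    calc A ^ p * q ^ L ≤ A ^ p * A ^ (-(p - 1)) := by gcongr
      _ = A := by
        rw [← Real.rpow_add hA]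
        simp
  have hsplit : ∑ k ∈ Finset.range K, n k ≤ ∑ k ∈ Finset.range L, (4 : ℝ) ^ k
      + ∑ k ∈ Finset.Ico L K, A ^ p * q ^ k := by
    rcases le_total K L with hKL | hKL
    · rw [Finset.Ico_eq_empty_of_le hKL, Finset.sum_empty, add_zero]
      exact (Finset.sum_le_sum fun k _ => h1 k).trans
        (Finset.sum_le_sum_of_subset_of_nonneg (Finset.range_mono hKL) fun _ _ _ => by positivity)
    · rw [← Finset.sum_range_add_sum_Ico _ hKL]
      exact add_le_add (Finset.sum_le_sum fun k _ => h1 k) (Finset.sum_le_sum fun k _ => h2 k)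
  calc ∑ k ∈ Finset.range K, n k
      ≤ 4 * A + A ^ p * (q ^ L / (1 - q)) := by
        refine hsplit.trans (add_le_add hL2 ?_)
        rw [← Finset.mul_sum]
        gcongr
        exact geom_sum_Ico_le_of_lt_one hq0.le hq1
    _ = 4 * A + A ^ p * q ^ L * (1 - q)⁻¹ := by ring
    _ ≤ 4 * A + A * (1 - q)⁻¹ := by
        have := inv_pos.2 (sub_pos.2 hq1)
        gcongr
    _ = (4 + (1 - q)⁻¹) * A := by ring

open Classical in
/-- The indices of the squares of level `k` whose weight exceeds `d`. -/
noncomputable def heavyCells (V : Plane → ℝ) (p : ℝ) (d : ℝ≥0∞) (k : ℕ) : Finset (ℕ × ℕ) :=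
  (Finset.range (2 ^ k) ×ˢ Finset.range (2 ^ k)).filter fun z => d < cellWeight V p k z

theorem mem_heavyCells {V : Plane → ℝ} {p : ℝ} {d : ℝ≥0∞} {k : ℕ} {z : ℕ × ℕ} :
    z ∈ heavyCells V p d k ↔ (z.1 < 2 ^ k ∧ z.2 < 2 ^ k) ∧ d < cellWeight V p k z := by
  simp [heavyCells]

theorem card_heavyCells_le (V : Plane → ℝ) (p : ℝ) (d : ℝ≥0∞) (k : ℕ) :
    ((heavyCells V p d k).card : ℝ) ≤ 4 ^ k := by
  have h : (heavyCells V p d k).card ≤ 4 ^ k := by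
    refine (Finset.card_filter_le _ _).trans ?_
    rw [Finset.card_product, Finset.card_range, ← mul_pow]
    norm_num
  exact_mod_cast h

theorem card_heavyCells_le_rpow (V : Plane → ℝ) {p : ℝ} (hp : 1 < p) {d : ℝ} (hd : 0 < d)
    (hV : eLpNorm V (ENNReal.ofReal p) (volume.restrict unitSquare) ≠ ⊤) (k : ℕ) :
    ((heavyCells V p (ENNReal.ofReal d) k).card : ℝ) ≤
      ((eLpNorm V (ENNReal.ofReal p) (volume.restrict unitSquare)).toReal / d ^ 2) ^ p
        * ((1 / 4 : ℝ) ^ (p - 1)) ^ k := by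
  have hp0 : 0 < p := by linarith
  set N := eLpNorm V (ENNReal.ofReal p) (volume.restrict unitSquare) with hN
  set S := heavyCells V p (ENNReal.ofReal d) k with hS
  have hr : (weightRatio p ^ (2 * k)) ^ p = ((1 / 4 : ℝ) ^ (p - 1)) ^ k := by
    rw [← Real.rpow_natCast, ← Real.rpow_natCast, ← Real.rpow_mul (weightRatio_pos p).le,
      weightRatio, ← Real.rpow_mul (by norm_num), ← Real.rpow_mul (by norm_num),
      show (1 / 4 : ℝ) = (1 / 2) ^ (2 : ℝ) by norm_num, ← Real.rpow_mul (by norm_num)]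
    congr 1
    push_cast
    field_simp
  have hz : ∀ z ∈ S, ENNReal.ofReal ((d ^ 2) ^ p) ≤
      eLpNorm V (ENNReal.ofReal p) (volume.restrict (dyadicCell k z)) ^ p
        * ENNReal.ofReal (((1 / 4 : ℝ) ^ (p - 1)) ^ k) := fun z hz => by
    have h1 := pow_le_pow_left' (mem_heavyCells.1 hz).2.le 2
    rw [cellWeight_sq, ← ENNReal.ofReal_pow hd.le, ← ENNReal.ofReal_pow (weightRatio_pos p).le]
      at h1
    have h2 := ENNReal.rpow_le_rpow h1 hp0.le
    rwa [ENNReal.mul_rpow_of_nonneg _ _ hp0.le, ENNReal.ofReal_rpow_of_nonneg (by positivity) hp0.le,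
      ENNReal.ofReal_rpow_of_nonneg (pow_nonneg (weightRatio_pos p).le _) hp0.le, hr] at h2
  have hsum : (S.card : ℝ≥0∞) * ENNReal.ofReal ((d ^ 2) ^ p)
      ≤ N ^ p * ENNReal.ofReal (((1 / 4 : ℝ) ^ (p - 1)) ^ k) := by
    rw [← nsmul_eq_mul]
    refine (Finset.card_nsmul_le_sum _ _ _ hz).trans ?_
    rw [← Finset.sum_mul, hN, ← tsum_eLpNorm_rpow_dyadicCell V hp0 k]
    gcongr
    exact ENNReal.sum_le_tsum _
  have hreal := ENNReal.toReal_mono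
    (ENNReal.mul_ne_top (ENNReal.rpow_ne_top_of_nonneg hp0.le hV) ENNReal.ofReal_ne_top) hsum
  rw [ENNReal.toReal_mul, ENNReal.toReal_mul, ENNReal.toReal_natCast,
    ENNReal.toReal_ofReal (by positivity), ENNReal.toReal_ofReal (by positivity),
    ← ENNReal.toReal_rpow] at hreal
  rw [Real.div_rpow ENNReal.toReal_nonneg (by positivity), div_mul_eq_mul_div,
    le_div_iff₀ (by positivity)]
  exact hreal

/-- The number of dyadic squares of weight larger than `d` is finite and at most linear in
`‖V‖_{L^p}`. -/
theorem exists_card_heavyCells_le {p : ℝ} (hp : 1 < p) {d : ℝ} (hd : 0 < d) :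
    ∃ C : ℝ, 0 < C ∧ ∀ V : Plane → ℝ,
      eLpNorm V (ENNReal.ofReal p) (volume.restrict unitSquare) ≠ ⊤ →
      ∃ K, (∀ k, K ≤ k → heavyCells V p (ENNReal.ofReal d) k = ∅) ∧
        ∑ k ∈ Finset.range K, ((heavyCells V p (ENNReal.ofReal d) k).card : ℝ) ≤
          C * (eLpNorm V (ENNReal.ofReal p) (volume.restrict unitSquare)).toReal := by
  obtain ⟨C, hC, h⟩ := exists_sum_le_of_le_pow p hp
  refine ⟨C / d ^ 2, by positivity, fun V hV => ?_⟩
  set A := (eLpNorm V (ENNReal.ofReal p) (volume.restrict unitSquare)).toReal / d ^ 2 with hA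
  have hA0 : 0 ≤ A := by positivity
  have hlim : Filter.Tendsto (fun k : ℕ => A ^ p * ((1 / 4 : ℝ) ^ (p - 1)) ^ k) Filter.atTop
      (nhds 0) := by
    simpa using (tendsto_pow_atTop_nhds_zero_of_lt_one
      (Real.rpow_nonneg (by norm_num : (0 : ℝ) ≤ 1 / 4) (p - 1))
      (Real.rpow_lt_one (by norm_num) (by norm_num) (by linarith))).const_mul (A ^ p)
  obtain ⟨K, hK⟩ := Filter.eventually_atTop.1 (hlim.eventually (gt_mem_nhds one_pos))
  refine ⟨K, fun k hk => ?_, ?_⟩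
  · have := (card_heavyCells_le_rpow V hp hd hV k).trans_lt (hK k hk)
    exact Finset.card_eq_zero.1 (Nat.lt_one_iff.1 (by exact_mod_cast this))
  · refine (h A hA0 _ (card_heavyCells_le V p _) (card_heavyCells_le_rpow V hp hd hV) K).trans_eq ?_
    rw [hA]
    ring

/-! ### Functions annihilated by the averages over the critical squares -/

/-- Every term with a heavy square drops out of the telescoping sum of the averages, since
both averages involved vanish. -/
theorem ae_enorm_le_tsum_of_cellMean_eq_zero {V f : Plane → ℝ} {g : Plane → Plane} {p : ℝ}
    (hp : 1 < p) {d : ℝ≥0∞} (hf : IsL2Loc unitSquare f) (hg : HasWeakGradient unitSquare f g)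
    (hgm : AEStronglyMeasurable g (volume.restrict unitSquare)) (h0 : cellMean f 0 (0, 0) = 0)
    (hheavy : ∀ k z, dyadicParent z ∈ heavyCells V p d k → cellMean f (k + 1) z = 0) :
    ∀ᵐ x ∂volume.restrict unitSquare, ‖f x‖ₑ ≤ ∑' k,
      if cellWeight V p k (dyadicIndex k x) ≤ d then ENNReal.ofReal (4 * bumpBound) *
        (∫⁻ y in dyadicCell k (dyadicIndex k x), ‖g y‖ₑ ^ 2) ^ (1 / 2 : ℝ) else 0 := by
  filter_upwards [ae_tendsto_cellMean hf, ae_restrict_mem measurableSet_unitSquare] with x hx hxQ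
  set m : ℕ → ℝ := fun k => cellMean f k (dyadicIndex k x) with hm
  set b : ℕ → ℝ≥0∞ := fun k => if cellWeight V p k (dyadicIndex k x) ≤ d then
    ENNReal.ofReal (4 * bumpBound) *
      (∫⁻ y in dyadicCell k (dyadicIndex k x), ‖g y‖ₑ ^ 2) ^ (1 / 2 : ℝ) else 0 with hb
  have hm0 : m 0 = 0 := by
    have h := dyadicIndex_lt (k := 0) hxQ
    have h' : dyadicIndex 0 x = (0, 0) := Prod.ext (by simpa using h.1) (by simpa using h.2)
    rw [hm]
    simp only [h', h0]
  have hmsucc : ∀ k, d < cellWeight V p k (dyadicIndex k x) → m (k + 1) = 0 := fun k hk =>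
    hheavy k _ (by
      rw [dyadicParent_dyadicIndex]
      exact mem_heavyCells.2 ⟨dyadicIndex_lt hxQ, hk⟩)
  have hmself : ∀ k, d < cellWeight V p k (dyadicIndex k x) → m k = 0 := fun k hk => by
    cases k with
    | zero => exact hm0
    | succ k =>
      refine hmsucc k (hk.trans_le ?_)
      refine (cellWeight_succ_le V p k _).trans ?_
      rw [dyadicParent_dyadicIndex]
      exact mul_le_of_le_one_left' (ENNReal.ofReal_le_one.2 (weightRatio_lt_one hp).le)
  have hstep : ∀ k, ‖m (k + 1) - m k‖ₑ ≤ b k := fun k => by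
    by_cases hk : cellWeight V p k (dyadicIndex k x) ≤ d
    · simp only [hb, if_pos hk]
      have h := enorm_cellMean_sub_le hf hg hgm (k := k) (dyadicIndex_lt (k := k + 1) hxQ)
      rwa [dyadicParent_dyadicIndex] at h
    · rw [not_le] at hk
      rw [hmsucc k hk, hmself k hk, sub_zero, enorm_zero]
      exact zero_le
  have hsum : ∀ n, ‖m n‖ₑ ≤ ∑ k ∈ Finset.range n, b k := fun n => by
    induction n with
    | zero => simp [hm0]
    | succ n ih =>
      calc ‖m (n + 1)‖ₑ = ‖m n + (m (n + 1) - m n)‖ₑ := by rw [add_sub_cancel]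
        _ ≤ ‖m n‖ₑ + ‖m (n + 1) - m n‖ₑ := enorm_add_le _ _
        _ ≤ _ := by
          rw [Finset.sum_range_succ]
          exact add_le_add ih (hstep n)
  exact le_of_tendsto ((continuous_enorm.tendsto _).comp hx)
    (Filter.Eventually.of_forall fun n => (hsum n).trans (ENNReal.sum_le_tsum _))

/-- The Poincaré–Sobolev type inequality for functions whose averages over the unit square and
over all children of heavy squares vanish. -/
theorem lintegral_potential_mul_sq_le {V f : Plane → ℝ} {g : Plane → Plane} {p : ℝ}
    (hp : 1 < p) {d : ℝ} (hd : 0 < d) (hV : AEStronglyMeasurable V (volume.restrict unitSquare))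
    (hf : IsL2Loc unitSquare f) (hg : HasWeakGradient unitSquare f g)
    (hgm : AEStronglyMeasurable g (volume.restrict unitSquare)) (h0 : cellMean f 0 (0, 0) = 0)
    (hheavy : ∀ k z, dyadicParent z ∈ heavyCells V p (ENNReal.ofReal d) k →
      cellMean f (k + 1) z = 0) :
    ∫⁻ x in unitSquare, ‖V x‖ₑ * ‖f x‖ₑ ^ 2 ≤
      ENNReal.ofReal ((4 * bumpBound * (d * (1 - weightRatio p)⁻¹)) ^ 2) *
        ∫⁻ x in unitSquare, ‖g x‖ₑ ^ 2 := by
  have hr0 := weightRatio_pos p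
  have hr1 := weightRatio_lt_one hp
  have hB := one_le_bumpBound
  have hconst : ENNReal.ofReal ((4 * bumpBound * (d * (1 - weightRatio p)⁻¹)) ^ 2)
      = (ENNReal.ofReal (4 * bumpBound)
        * (ENNReal.ofReal d * (1 - ENNReal.ofReal (weightRatio p))⁻¹)) ^ 2 := by
    have := inv_pos.2 (sub_pos.2 hr1)
    rw [ENNReal.ofReal_pow (by positivity), ENNReal.ofReal_mul (by positivity),
      ENNReal.ofReal_mul hd.le, ENNReal.ofReal_inv_of_pos (sub_pos.2 hr1),
      ENNReal.ofReal_sub _ hr0.le, ENNReal.ofReal_one]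
  rw [hconst]
  have hrk : ∀ k, ENNReal.ofReal d * ENNReal.ofReal (weightRatio p) ^ k ≤ ENNReal.ofReal d :=
    fun k => mul_le_of_le_one_right' (pow_le_one' (ENNReal.ofReal_le_one.2 hr1.le) k)
  -- The weight is raised to `d rᵏ` where it is smaller; this keeps it positive and does not
  -- change which squares are heavy.
  refine lintegral_mul_sq_le_of_dyadic hV.enorm (hgm.enorm.pow_const 2)
    (fun k z => max (cellWeight V p k z) (ENNReal.ofReal d * ENNReal.ofReal (weightRatio p) ^ k))
    ENNReal.ofReal_ne_top (fun k z => ?_) (fun k z => ?_) (fun k z => ?_) ?_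
  · refine (lt_of_lt_of_le ?_ (le_max_right _ _)).ne'
    exact ENNReal.mul_pos (ENNReal.ofReal_pos.2 hd).ne'
      (pow_ne_zero k (ENNReal.ofReal_pos.2 hr0).ne')
  · refine max_le ((cellWeight_succ_le V p k z).trans (by gcongr; exact le_max_left _ _)) ?_
    calc ENNReal.ofReal d * ENNReal.ofReal (weightRatio p) ^ (k + 1)
        = ENNReal.ofReal (weightRatio p)
          * (ENNReal.ofReal d * ENNReal.ofReal (weightRatio p) ^ k) := by ring
      _ ≤ _ := by gcongr; exact le_max_right _ _
  · exact (lintegral_dyadicCell_le_cellWeight_sq hV hp k z).trans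
      (pow_le_pow_left' (le_max_left _ _) 2)
  · filter_upwards [ae_enorm_le_tsum_of_cellMean_eq_zero hp hf hg hgm h0 hheavy] with x hx
    simpa only [max_le_iff, hrk, and_true] using hx

/-- The averages over the unit square and the children of heavy squares detect the constants, and
indeed every function with vanishing gradient. -/
theorem ae_eq_zero_of_lintegral_gradient_eq_zero {V f : Plane → ℝ} {g : Plane → Plane} {p : ℝ}
    (hp : 1 < p) {d : ℝ≥0∞} (hf : IsL2Loc unitSquare f) (hg : HasWeakGradient unitSquare f g)
    (hgm : AEStronglyMeasurable g (volume.restrict unitSquare)) (h0 : cellMean f 0 (0, 0) = 0)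
    (hheavy : ∀ k z, dyadicParent z ∈ heavyCells V p d k → cellMean f (k + 1) z = 0)
    (hg0 : ∫⁻ x in unitSquare, ‖g x‖ₑ ^ 2 = 0) : f =ᵐ[volume.restrict unitSquare] 0 := by
  filter_upwards [ae_enorm_le_tsum_of_cellMean_eq_zero hp hf hg hgm h0 hheavy] with x hx
  have hcell : ∀ k z, ∫⁻ y in dyadicCell k z, ‖g y‖ₑ ^ 2 = 0 := fun k z =>
    le_antisymm ((lintegral_mono_set (dyadicCell_subset_unitSquare k z)).trans hg0.le) zero_le
  simpa [hcell] using hx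

/-! ### Linear functionals and the Morse index -/

theorem cellMean_congr {f h : Plane → ℝ} (hfh : f =ᵐ[volume.restrict unitSquare] h) (k : ℕ)
    (z : ℕ × ℕ) : cellMean f k z = cellMean h k z :=
  integral_congr_ae (hfh.mono fun x hx => by simp only [hx])

theorem cellMean_add {f h : Plane → ℝ} (hf : IsL2Loc unitSquare f) (hh : IsL2Loc unitSquare h)
    {k : ℕ} {z : ℕ × ℕ} (hz : z.1 < 2 ^ k ∧ z.2 < 2 ^ k) :
    cellMean (f + h) k z = cellMean f k z + cellMean h k z := by
  rw [cellMean, cellMean, cellMean,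
    ← integral_add (hf.integrableOn_mul_bump hz) (hh.integrableOn_mul_bump hz)]
  simp only [Pi.add_apply, add_mul]

theorem cellMean_smul (c : ℝ) (f : Plane → ℝ) (k : ℕ) (z : ℕ × ℕ) :
    cellMean (c • f) k z = c * cellMean f k z := by
  rw [cellMean, cellMean, ← integral_const_mul]
  simp only [Pi.smul_apply, smul_eq_mul, mul_assoc]

/-- The smooth averages over finitely many dyadic squares, as a linear map on a space of
locally square integrable functions. -/
noncomputable def cellMeans {W : Submodule ℝ (Plane →ₘ[volume.restrict unitSquare] ℝ)}
    (hW : ∀ f ∈ W, IsL2Loc unitSquare f) (s : Finset (ℕ × ℕ × ℕ))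
    (hs : ∀ t ∈ s, t.2.1 < 2 ^ t.1 ∧ t.2.2 < 2 ^ t.1) : W →ₗ[ℝ] s → ℝ where
  toFun f t := cellMean f.1 t.1.1 t.1.2
  map_add' f h := by
    ext t
    exact (cellMean_congr (AEEqFun.coeFn_add f.1 h.1) _ _).trans
      (cellMean_add (hW f.1 f.2) (hW h.1 h.2) (hs t.1 t.2))
  map_smul' c f := by
    ext t
    exact (cellMean_congr (AEEqFun.coeFn_smul c f.1) _ _).trans (cellMean_smul c f.1 _ _)

theorem hasWeakGradient_weakGradient {Ω : Set Plane} {f : Plane → ℝ}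
    (h : ∃ g, HasWeakGradient Ω f g) : HasWeakGradient Ω f (weakGradient Ω f) := by
  rw [weakGradient, dif_pos h]
  exact h.choose_spec

theorem memLp_weakGradient {f : Plane → ℝ}
    (h : ∃ g, HasWeakGradient unitSquare f g ∧ MemLp g 2 (volume.restrict unitSquare)) :
    MemLp (weakGradient unitSquare f) 2 (volume.restrict unitSquare) := by
  obtain ⟨g, hg, hg2⟩ := h
  exact hg2.ae_eq (hg.ae_eq isOpen_unitSquare (hasWeakGradient_weakGradient ⟨g, hg⟩))

/-- Nonpositive energy, as an inequality between Lebesgue integrals in `[0, ∞]`. -/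
theorem lintegral_gradient_le_of_energyForm_nonpos {V : Plane → ℝ}
    {f : Plane →ₘ[volume.restrict unitSquare] ℝ}
    (hg : MemLp (weakGradient unitSquare f) 2 (volume.restrict unitSquare))
    (hE : energyForm unitSquare V f ≤ 0) :
    ∫⁻ x in unitSquare, ‖weakGradient unitSquare f x‖ₑ ^ 2
      ≤ ∫⁻ x in unitSquare, ‖V x‖ₑ * ‖f x‖ₑ ^ 2 := by
  have hint : Integrable (fun x => ‖weakGradient unitSquare f x‖ ^ 2)
      (volume.restrict unitSquare) := hg.integrable_norm_pow two_ne_zero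
  calc ∫⁻ x in unitSquare, ‖weakGradient unitSquare f x‖ₑ ^ 2
      = ENNReal.ofReal (∫ x in unitSquare, ‖weakGradient unitSquare f x‖ ^ 2) := by
        rw [ofReal_integral_eq_lintegral_ofReal hint
          (Filter.Eventually.of_forall fun x => by positivity)]
        simp only [ENNReal.ofReal_pow (norm_nonneg _), ofReal_norm]
    _ ≤ ENNReal.ofReal (∫ x in unitSquare, V x * f x ^ 2) :=
        ENNReal.ofReal_le_ofReal (sub_nonpos.1 hE)
    _ ≤ ‖∫ x in unitSquare, V x * f x ^ 2‖ₑ := Real.ofReal_le_enorm _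
    _ ≤ ∫⁻ x in unitSquare, ‖V x * f x ^ 2‖ₑ := enorm_integral_le_lintegral_enorm _
    _ = ∫⁻ x in unitSquare, ‖V x‖ₑ * ‖f x‖ₑ ^ 2 := by simp only [enorm_mul, enorm_pow]

/-- The levels and indices of the unit square and of the children of the heavy squares of
level below `K`. -/
noncomputable def criticalCells (V : Plane → ℝ) (p : ℝ) (d : ℝ≥0∞) (K : ℕ) :
    Finset (ℕ × ℕ × ℕ) :=
  insert (0, 0, 0) ((Finset.range K).biUnion fun k =>
    (heavyCells V p d k ×ˢ (Finset.range 2 ×ˢ Finset.range 2)).image fun t =>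
      (k + 1, 2 * t.1.1 + t.2.1, 2 * t.1.2 + t.2.2))

theorem card_criticalCells_le (V : Plane → ℝ) (p : ℝ) (d : ℝ≥0∞) (K : ℕ) :
    (criticalCells V p d K).card ≤ 1 + 4 * ∑ k ∈ Finset.range K, (heavyCells V p d k).card := by
  refine (Finset.card_insert_le _ _).trans ?_
  rw [add_comm, Finset.mul_sum]
  gcongr
  refine Finset.card_biUnion_le.trans (Finset.sum_le_sum fun k _ => Finset.card_image_le.trans ?_)
  simp [Finset.card_product, mul_comm]

theorem lt_of_mem_criticalCells {V : Plane → ℝ} {p : ℝ} {d : ℝ≥0∞} {K : ℕ} {t : ℕ × ℕ × ℕ}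
    (ht : t ∈ criticalCells V p d K) : t.2.1 < 2 ^ t.1 ∧ t.2.2 < 2 ^ t.1 := by
  simp only [criticalCells, Finset.mem_insert, Finset.mem_biUnion, Finset.mem_image,
    Finset.mem_product, Finset.mem_range, mem_heavyCells] at ht
  rcases ht with rfl | ⟨k, -, s, ⟨⟨⟨h1, h2⟩, -⟩, h3, h4⟩, rfl⟩
  · simp
  · simp only [pow_succ]
    omega

theorem mem_criticalCells_of_dyadicParent {V : Plane → ℝ} {p : ℝ} {d : ℝ≥0∞} {K k : ℕ}
    {z : ℕ × ℕ} (hK : ∀ k, K ≤ k → heavyCells V p d k = ∅)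
    (hz : dyadicParent z ∈ heavyCells V p d k) : (k + 1, z) ∈ criticalCells V p d K := by
  have hk : k < K := by
    by_contra! h
    rw [hK k h] at hz
    exact Finset.notMem_empty _ hz
  refine Finset.mem_insert_of_mem (Finset.mem_biUnion.2 ⟨k, Finset.mem_range.2 hk,
    Finset.mem_image.2 ⟨(dyadicParent z, z.1 % 2, z.2 % 2), ?_, ?_⟩⟩)
  · simp only [Finset.mem_product, Finset.mem_range]
    exact ⟨hz, Nat.mod_lt _ two_pos, Nat.mod_lt _ two_pos⟩
  · simp only [dyadicParent, Nat.div_add_mod]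

/-- On a subspace of nonpositive energy the averages over the critical squares separate points,
so the Morse index is at most the number of critical squares. The threshold `d` makes the
constant in `lintegral_potential_mul_sq_le` equal to `1/4`. -/
theorem morseIndex_le_card_criticalCells {V : Plane → ℝ}
    (hV : AEStronglyMeasurable V (volume.restrict unitSquare)) {p : ℝ} (hp : 1 < p) {d : ℝ}
    (hd : d = (1 - weightRatio p) / (8 * bumpBound)) {K : ℕ}
    (hK : ∀ k, K ≤ k → heavyCells V p (ENNReal.ofReal d) k = ∅) :
    morseIndex V unitSquare ≤ (criticalCells V p (ENNReal.ofReal d) K).card := by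
  have hr := sub_pos.2 (weightRatio_lt_one hp)
  have hB := one_le_bumpBound
  have hd0 : 0 < d := by
    rw [hd]
    positivity
  refine iSup₂_le fun W hW => ?_
  have hinj : Function.Injective (cellMeans (fun f hf => (hW.1 f hf).1)
      (criticalCells V p (ENNReal.ofReal d) K) fun t ht => lt_of_mem_criticalCells ht) := by
    rw [injective_iff_map_eq_zero]
    rintro ⟨f, hfW⟩ hf
    obtain ⟨hf2, hgex, -⟩ := hW.1 f hfW
    have hg := hasWeakGradient_weakGradient (hgex.imp fun _ h => h.1)
    have hg2 := memLp_weakGradient hgex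
    have hzero : ∀ t ∈ criticalCells V p (ENNReal.ofReal d) K, cellMean f t.1 t.2 = 0 :=
      fun t ht => congrFun hf ⟨t, ht⟩
    have h0 : cellMean f 0 (0, 0) = 0 := hzero (0, 0, 0) (Finset.mem_insert_self _ _)
    have hheavy : ∀ k z, dyadicParent z ∈ heavyCells V p (ENNReal.ofReal d) k →
        cellMean f (k + 1) z = 0 := fun k z hz =>
      hzero (k + 1, z) (mem_criticalCells_of_dyadicParent hK hz)
    have hle := (lintegral_gradient_le_of_energyForm_nonpos hg2 (hW.2 f hfW)).trans
      (lintegral_potential_mul_sq_le hp hd0 hV hf2 hg hg2.aestronglyMeasurable h0 hheavy)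
    have hquarter : (4 * bumpBound * (d * (1 - weightRatio p)⁻¹)) ^ 2 = 1 / 4 := by
      rw [hd]
      field_simp
      norm_num
    rw [hquarter] at hle
    have hfin : ∫⁻ x in unitSquare, ‖weakGradient unitSquare f x‖ₑ ^ 2 ≠ ⊤ := by
      have h := hg2.integrable_norm_pow two_ne_zero
      have h' := h.hasFiniteIntegral.ne
      simpa only [enorm_pow, enorm_norm] using h'
    have hG0 : ∫⁻ x in unitSquare, ‖weakGradient unitSquare f x‖ₑ ^ 2 = 0 := by
      have h := ENNReal.toReal_mono (ENNReal.mul_ne_top ENNReal.ofReal_ne_top hfin) hle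
      rw [ENNReal.toReal_mul, ENNReal.toReal_ofReal (by norm_num)] at h
      have h0 := ENNReal.toReal_nonneg
        (a := ∫⁻ x in unitSquare, ‖weakGradient unitSquare f x‖ₑ ^ 2)
      exact ((ENNReal.toReal_eq_zero_iff _).1 (by linarith)).resolve_right hfin
    have hae := ae_eq_zero_of_lintegral_gradient_eq_zero hp hf2 hg hg2.aestronglyMeasurable
      h0 hheavy hG0
    exact Subtype.ext (AEEqFun.ext (hae.trans AEEqFun.coeFn_zero.symm))
  have hrank := LinearMap.rank_le_of_injective _ hinj
  rw [rank_fun', Fintype.card_coe] at hrank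
  exact Cardinal.toENat_le_natCast.2 hrank

theorem lemma4 (p : ℝ) (hp : 1 < p) :
    ∃ C : ℝ≥0, ∀ V : Plane → ℝ, IsPotential unitSquare V →
      (morseIndex V unitSquare : ℝ≥0∞) ≤
        1 + (C : ℝ≥0∞) * eLpNorm V (ENNReal.ofReal p) (volume.restrict unitSquare) := by
  have hB := one_le_bumpBound
  obtain ⟨C, hC, h⟩ := exists_card_heavyCells_le hp
    (d := (1 - weightRatio p) / (8 * bumpBound)) (div_pos (sub_pos.2 (weightRatio_lt_one hp))
      (by linarith))
  refine ⟨(4 * C).toNNReal, fun V hV => ?_⟩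
  rw [← ENNReal.ofReal]
  by_cases hN : eLpNorm V (ENNReal.ofReal p) (volume.restrict unitSquare) = ⊤
  -- The constant must be nonzero here, because `0 * ⊤ = 0`.
  · rw [hN, ENNReal.mul_top (ENNReal.ofReal_pos.2 (by linarith)).ne', add_top]
    exact le_top
  obtain ⟨K, hK, hsum⟩ := h V hN
  have hidx := (morseIndex_le_card_criticalCells
    (hV.locallyIntegrable.aestronglyMeasurable) hp rfl hK).trans
    (Nat.cast_le.2 (card_criticalCells_le _ _ _ _))
  refine (ENat.toENNReal_le.2 hidx).trans ?_
  rw [ENat.toENNReal_coe]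
  push_cast
  refine add_le_add le_rfl ?_
  rw [← ENNReal.ofReal_toReal hN, ← ENNReal.ofReal_mul (by linarith)]
  have hcast : (4 : ℝ≥0∞) * ∑ k ∈ Finset.range K, ((heavyCells V p (ENNReal.ofReal
        ((1 - weightRatio p) / (8 * bumpBound))) k).card : ℝ≥0∞)
      = ENNReal.ofReal (4 * ∑ k ∈ Finset.range K, ((heavyCells V p (ENNReal.ofReal
        ((1 - weightRatio p) / (8 * bumpBound))) k).card : ℝ)) := by
    rw [ENNReal.ofReal_mul (by norm_num), ENNReal.ofReal_sum_of_nonneg fun _ _ => by positivity]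
    simp
  rw [hcast]
  refine ENNReal.ofReal_le_ofReal ?_
  rw [mul_assoc]
  exact mul_le_mul_of_nonneg_left hsum (by norm_num)
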